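/- \textbf{Theorem (Haglund's axis theorem).} Let $X$ be a CAT(0) cube complex, that is, a simply connected cubical complex (cubes are embedded, and two cubes that meet do so in a common face) in which the link of every $0$-cube is a flag simplicial complex. Let $G$ be a group acting on $X$ by automorphisms (preserving the cell structure and mapping cubes isometrically to cubes) and without inversions: for every hyperplane $\Lambda$ of $X$, each element of $G$ stabilizing $\Lambda$ also stabilizes each component of the complement of $\Lambda$. Here a hyperplane is identified with the set of $1$-cubes dual to it, i.e. with an equivalence class of $1$-cubes under the equivalence relation generated by being opposite in a $2$-cube, and its complementary components are given by the components of the $1$-skeleton after removing the open $1$-cubes dual to it. Then for every $g \in G$, either $g$ fixes a $0$-cube of $X$, or there is a combinatorial geodesic axis for $g$: a subcomplex $\gamma \subseteq X$ with $g\gamma = \gamma$ that is homeomorphic to $\mathbb{R}$ and isometrically embedded for the combinatorial metric, i.e. for any two $0$-cubes of $\gamma$ the length of a shortest edge path joining them in $\gamma$ equals the length of a shortest edge path joining them in $X$. -/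

import Mathlib

open scoped Pointwise

/-- `IsCubeChart cubes φ`: the map `φ` from the vertices `{0,1}ⁿ` of the standard `n`-cube
identifies it with a member of the family `cubes` of vertex sets.  It is injective, its range is
a member of the family, and the members of the family contained in its range are exactly the
images of the (nonempty) faces `{ε | ∀ i ∈ I, ε i = a i}` of the standard cube. -/
def IsCubeChart {V : Type*} (cubes : Set (Set V)) {n : ℕ} (φ : (Fin n → Bool) → V) : Prop :=
  Function.Injective φ ∧ Set.range φ ∈ cubes ∧
    ∀ t : Set V, t ⊆ Set.range φ →
      (t ∈ cubes ↔ ∃ (I : Set (Fin n)) (a : Fin n → Bool), t = φ '' {ε | ∀ i ∈ I, ε i = a i})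

/-- A cubical complex with set of `0`-cubes `V`.  A cube is recorded by the set of its vertices:
cubes are embedded, every face of a cube is a cube, and two cubes that meet
do so in a single common face. -/
structure CubeComplex (V : Type*) where
  /-- The vertex sets of the cubes of the complex. -/
  cubes : Set (Set V)
  singleton_mem : ∀ v : V, {v} ∈ cubes
  exists_chart : ∀ c ∈ cubes, ∃ (n : ℕ) (φ : (Fin n → Bool) → V),
    IsCubeChart cubes φ ∧ Set.range φ = c
  inter_mem : ∀ c ∈ cubes, ∀ d ∈ cubes, (c ∩ d).Nonempty → c ∩ d ∈ cubes

namespace CubeComplex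

/-- The `1`-skeleton.  Its path metric `K.graph.dist` (or `K.graph.edist`, with value `⊤` on
pairs not joined by a path) is the combinatorial metric on the `0`-cubes. -/
def graph {V : Type*} (K : CubeComplex V) : SimpleGraph V where
  Adj u v := u ≠ v ∧ {u, v} ∈ K.cubes
  symm := ⟨fun u v h => ⟨h.1.symm, by rw [Set.pair_comm]; exact h.2⟩⟩
  loopless := ⟨fun _ h => h.1 rfl⟩

/-! ### Geometric realization -/

open Classical in
/-- The point of the cube with vertices `φ ε` whose cube coordinates are `t ∈ [0,1]ⁿ`, recorded
by its weights on the vertices: the vertex `φ ε` has weight `∏ i, (t i if ε i = 1, else 1 - t i)`,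
and vertices outside the cube have weight `0`. -/
noncomputable def cubePoint {V : Type*} {n : ℕ} (φ : (Fin n → Bool) → V)
    (t : Fin n → unitInterval) : V → ℝ :=
  fun v => ∑ ε : Fin n → Bool,
    if φ ε = v then ∏ i, (if ε i = true then (t i : ℝ) else 1 - (t i : ℝ)) else 0

/-- The points of the geometric realization `|K|`: the points of the geometric cubes of `K`.
A point lying in several cubes has the same weights in each of them, so that cubes
are glued along their common faces. -/
def Realization {V : Type*} (K : CubeComplex V) : Type _ :=
  {x : V → ℝ // ∃ (n : ℕ) (φ : (Fin n → Bool) → V) (t : Fin n → unitInterval),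
    IsCubeChart K.cubes φ ∧ x = cubePoint φ t}

/-- The characteristic map `[0,1]ⁿ → |K|` of a cube of `K`. -/
noncomputable def charMap {V : Type*} (K : CubeComplex V) {n : ℕ} (φ : (Fin n → Bool) → V)
    (hφ : IsCubeChart K.cubes φ) (t : Fin n → unitInterval) : K.Realization :=
  ⟨cubePoint φ t, n, φ, t, hφ, rfl⟩

/-- The weak topology: a set is open if and only if its preimage under every characteristic map
is open. -/
noncomputable instance {V : Type*} (K : CubeComplex V) : TopologicalSpace K.Realization :=
  ⨆ (n : ℕ) (φ : (Fin n → Bool) → V) (hφ : IsCubeChart K.cubes φ),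
    TopologicalSpace.coinduced (K.charMap φ hφ) inferInstance

/-! ### CAT(0) cube complexes -/

/-- The simplices of the link of the `0`-cube `v`.  The vertices of the link are the `1`-cubes at
`v`, recorded by their other endpoints; a finite set of them spans a simplex if the `1`-cubes lie
in a common cube. -/
def link {V : Type*} (K : CubeComplex V) (v : V) : Set (Set V) :=
  {S | S.Finite ∧ (∀ u ∈ S, K.graph.Adj v u) ∧ ∃ c ∈ K.cubes, v ∈ c ∧ S ⊆ c}

/-- The link of `v` is a flag complex: finitely many vertices of the link span a simplex as soon as
any two of them do. -/
def LinkIsFlag {V : Type*} (K : CubeComplex V) (v : V) : Prop :=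
  ∀ S : Set V, S.Finite → (∀ u ∈ S, K.graph.Adj v u) →
    (∀ a ∈ S, ∀ b ∈ S, a ≠ b → {a, b} ∈ K.link v) → S ∈ K.link v

/-- A CAT(0) cube complex: a simply connected cubical complex in which the link of every `0`-cube
is a flag complex. -/
structure IsCAT0 {V : Type*} (K : CubeComplex V) : Prop where
  simplyConnected : SimplyConnectedSpace K.Realization
  linkIsFlag : ∀ v : V, K.LinkIsFlag v

/-! ### Hyperplanes -/

/-- `e` and `f` are opposite `1`-cubes of a `2`-cube of `K`. -/
def Opposite {V : Type*} (K : CubeComplex V) (e f : Sym2 V) : Prop :=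
  ∃ φ : (Fin 2 → Bool) → V, IsCubeChart K.cubes φ ∧
    e = s(φ ![false, false], φ ![true, false]) ∧ f = s(φ ![false, true], φ ![true, true])

/-- A hyperplane, recorded by the set of `1`-cubes dual to it: an equivalence class of `1`-cubes
under the equivalence relation generated by being opposite in a `2`-cube. -/
def IsHyperplane {V : Type*} (K : CubeComplex V) (H : Set (Sym2 V)) : Prop :=
  ∃ e ∈ K.graph.edgeSet, H = {f | Relation.EqvGen K.Opposite e f}

/-- The complementary components of a hyperplane `H`, recorded by their `0`-cubes: the connected
components of the `1`-skeleton with the (open) `1`-cubes dual to `H` removed. -/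
def IsComplementaryComponent {V : Type*} (K : CubeComplex V) (H : Set (Sym2 V)) (A : Set V) :
    Prop :=
  ∃ C : (K.graph.deleteEdges H).ConnectedComponent, A = C.supp

/-! ### Group actions -/

/-- The action of `G` on the `0`-cubes maps cubes to cubes, i.e. `G` acts on `K`
by automorphisms. -/
def PreservedBy {V : Type*} (K : CubeComplex V) (G : Type*) [Group G] [MulAction G V] : Prop :=
  ∀ (g : G), ∀ c ∈ K.cubes, g • c ∈ K.cubes

/-- `G` acts without inversions: the stabilizer of a hyperplane also stabilizes each of its
complementary components. -/
def WithoutInversions {V : Type*} (K : CubeComplex V) (G : Type*) [Group G] [MulAction G V] :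
    Prop :=
  ∀ H : Set (Sym2 V), K.IsHyperplane H → ∀ g : G, Sym2.map (fun v => g • v) '' H = H →
    ∀ A : Set V, K.IsComplementaryComponent H A → g • A = A

/-! ### Subcomplexes and axes -/

/-- A subcomplex: a set of cubes of `K` containing every face of each of its members. -/
structure Subcomplex {V : Type*} (K : CubeComplex V) where
  /-- The cubes of the subcomplex. -/
  carrier : Set (Set V)
  carrier_subset : carrier ⊆ K.cubes
  face_mem : ∀ c ∈ carrier, ∀ d ∈ K.cubes, d ⊆ c → d ∈ carrier

/-- The `1`-skeleton of a subcomplex (on all of `V`; vertices outside it are isolated). -/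
def Subcomplex.graph {V : Type*} {K : CubeComplex V} (Y : K.Subcomplex) : SimpleGraph V where
  Adj u v := u ≠ v ∧ {u, v} ∈ Y.carrier
  symm := ⟨fun u v h => ⟨h.1.symm, by rw [Set.pair_comm]; exact h.2⟩⟩
  loopless := ⟨fun _ h => h.1 rfl⟩

/-- The subspace of `|K|` underlying a subcomplex: the union of its closed cubes.  A point of `|K|`
lies in the closed cube `c` if and only if its weights vanish outside `c`. -/
def Subcomplex.space {V : Type*} {K : CubeComplex V} (Y : K.Subcomplex) : Set K.Realization :=
  {x | ∃ c ∈ Y.carrier, ∀ v, x.1 v ≠ 0 → v ∈ c}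

/-- A subcomplex is isometrically embedded for the combinatorial metric: the combinatorial distance
of two of its `0`-cubes is the same in the subcomplex and in `K`. -/
def Subcomplex.IsometricallyEmbedded {V : Type*} {K : CubeComplex V} (Y : K.Subcomplex) : Prop :=
  ∀ u v : V, {u} ∈ Y.carrier → {v} ∈ Y.carrier → Y.graph.edist u v = K.graph.edist u v

/-- A combinatorial geodesic axis for `g`: a `g`-invariant, isometrically embedded subcomplex
homeomorphic to `ℝ`. -/
structure IsCombinatorialGeodesicAxis {V G : Type*} [Group G] [MulAction G V] (K : CubeComplex V)
    (g : G) (Y : K.Subcomplex) : Prop where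
  invariant : (fun c : Set V => g • c) '' Y.carrier = Y.carrier
  isometric : Y.IsometricallyEmbedded
  homeomorphic : Nonempty (Y.space ≃ₜ ℝ)

end CubeComplex

/-! ### Flat sections of local systems over a simply connected space -/

/-! Write d for the combinatorial metric and choose a vertex v whose displacement δ under g is
minimal. If δ = 0, then v is fixed. Otherwise it suffices that d(v, gⁿv) = nδ for all n: the
translates of a geodesic from v to gv then concatenate to a geodesic line (`exists_line`). The
equality is proved by induction on n (`dist_pow_smul`). If d(v, gⁿ⁺¹v) < (n+1)δ, then gⁿv is not
between v and gⁿ⁺¹v, so it has a neighbour gⁿw closer to both. Now w has displacement δ as well, and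
the induction hypothesis for v and w shows that gⁿ sends the edge vw to an edge crossing the
hyperplane of vw in the opposite direction. This is an inversion.

The argument needs the closer neighbour (`exists_adj_closer`) and the description of the side of v
of the hyperplane of vw as the halfspace d(v, ·) < d(w, ·) (`reachable_deleteEdges_iff`). Both
follow from bipartiteness (`dist_of_adj`) and the quadrangle condition (`quadrangle`) for the
1-skeleton.

These in turn come from edge paths modulo square moves. Flagness of links controls the final edges
of equivalent paths (`exists_exchange`). It follows that each edge uv induces mutually inverse maps
between the classes of reduced paths from x₀ to u and to v (`ReductionStep`), compatibly with
squares. Simple connectivity gives this local system a global flat section (`exists_flat_section`).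
The section through the trivial path takes at v the class of every reduced path to v, so all of
these are equivalent (`IsReduced.pathEquiv`). Hence reduced paths are geodesics, and the exchange of
final edges becomes the quadrangle condition. -/

/-- Over a simply connected, locally path connected space, a local system given by a cover by
connected open sets and constant transition functions has a flat section through every point. -/
theorem exists_flat_section_of_cover {ι B F : Type*} [TopologicalSpace B] [SimplyConnectedSpace B]
    [LocallyPathConnectedSpace B] (U : ι → Set B) (hUo : ∀ i, IsOpen (U i))
    (hUc : ∀ i, IsPreconnected (U i)) (hU : ∀ x, ∃ i, x ∈ U i) (T : ι → ι → F → F)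
    (hself : ∀ i, (U i).Nonempty → ∀ f, T i i f = f)
    (hcomp : ∀ i j k, (U i ∩ U j ∩ U k).Nonempty → ∀ f, T j k (T i j f) = T i k f)
    (i₀ : ι) (h₀ : (U i₀).Nonempty) (f₀ : F) :
    ∃ s : ι → F, s i₀ = f₀ ∧ ∀ i j, (U i ∩ U j).Nonempty → T i j (s i) = s j := by
  classical
  let _ : TopologicalSpace F := ⊥
  have : DiscreteTopology F := ⟨rfl⟩
  choose ix hix using hU
  -- With discrete fibre, the bundle glued from `T` is a covering space. The identity of the simply
  -- connected base lifts to a section, which is constant in each chart because `U i` is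
  -- preconnected.
  let Z : FiberBundleCore ι B F :=
    { baseSet := U
      isOpen_baseSet := hUo
      indexAt := ix
      mem_baseSet_at := hix
      coordChange := fun i j _ => T i j
      coordChange_self := fun i x hx v => hself i ⟨x, hx⟩ v
      continuousOn_coordChange := fun i j =>
        (continuous_of_discreteTopology.comp continuous_snd).continuousOn
      coordChange_comp := fun i j k x hx v => hcomp i j k ⟨x, hx⟩ v }
  have hcov : IsCoveringMap Z.proj :=
    IsFiberBundle.isCoveringMap fun x => ⟨Z.localTriv (ix x), hix x⟩
  obtain ⟨x₀, hx₀⟩ := h₀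
  let e₀ : Z.TotalSpace := ⟨x₀, T i₀ (ix x₀) f₀⟩
  obtain ⟨S, ⟨hS₀, hS⟩, -⟩ := hcov.existsUnique_continuousMap_lifts (ContinuousMap.id B) x₀ e₀ rfl
  have hproj : ∀ x, (S x).proj = x := fun x => congrFun hS x
  let σ : ι → B → F := fun i x => T (ix (S x).proj) i (S x).2
  have hσ : ∀ i, ContinuousOn (σ i) (U i) := by
    intro i
    have h1 : ContinuousOn (Z.localTriv i) (Z.localTriv i).source :=
      (Z.localTriv i).continuousOn_toFun
    have h2 : ContinuousOn (fun x => (Z.localTriv i (S x)).2) (U i) := by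
      refine continuous_snd.comp_continuousOn (h1.comp S.continuous.continuousOn ?_)
      intro x hx
      change (S x).proj ∈ U i
      rw [hproj]; exact hx
    exact h2
  have hconst : ∀ i, ∀ x ∈ U i, ∀ y ∈ U i, σ i x = σ i y := by
    intro i x hx y hy
    exact (hUc i).constant (hσ i) hx hy
  have htrans : ∀ i j, ∀ x ∈ U i ∩ U j, T i j (σ i x) = σ j x := by
    intro i j x hx
    refine hcomp _ i j ⟨x, ⟨?_, hx.1⟩, hx.2⟩ _
    rw [hproj]; exact hix x
  have hσ₀ : σ i₀ x₀ = f₀ := by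
    have : σ i₀ x₀ = T (ix x₀) i₀ (T i₀ (ix x₀) f₀) := by
      simp only [σ]; rw [hS₀]
    rw [this, hcomp _ _ _ ⟨x₀, ⟨hx₀, hix x₀⟩, hx₀⟩, hself _ ⟨x₀, hx₀⟩]
  -- The value on an empty `U i` is irrelevant, since no overlap involves it.
  refine ⟨fun i => if h : (U i).Nonempty then σ i h.some else f₀, ?_, ?_⟩
  · have h : (U i₀).Nonempty := ⟨x₀, hx₀⟩
    simp only [dif_pos h]
    rw [← hσ₀]
    exact hconst _ _ (Set.Nonempty.some_mem _) _ hx₀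
  · rintro i j ⟨x, hx⟩
    have h : (U i).Nonempty := ⟨x, hx.1⟩
    have h' : (U j).Nonempty := ⟨x, hx.2⟩
    simp only [dif_pos h, dif_pos h']
    rw [hconst i _ (Set.Nonempty.some_mem _) x hx.1, hconst j _ (Set.Nonempty.some_mem _) x hx.2]
    exact htrans i j x hx

namespace CubeComplex

variable {V : Type*} {K : CubeComplex V}

/-! ### Topology of the realization -/

theorem continuous_cubePoint_apply {n : ℕ} (φ : (Fin n → Bool) → V) (v : V) :
    Continuous fun t : Fin n → unitInterval => cubePoint φ t v := by
  unfold cubePoint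
  refine continuous_finsetSum _ fun ε _ => ?_
  split_ifs
  · refine continuous_finsetProd _ fun i _ => ?_
    split_ifs <;> fun_prop
  · exact continuous_const

theorem continuous_charMap {n : ℕ} {φ : (Fin n → Bool) → V} (hφ : IsCubeChart K.cubes φ) :
    Continuous (K.charMap φ hφ) := by
  rw [continuous_iff_coinduced_le]
  exact le_iSup_of_le n (le_iSup_of_le φ (le_iSup_of_le hφ le_rfl))

theorem continuous_realization_dom {Y : Type*} [TopologicalSpace Y] {f : K.Realization → Y}
    (h : ∀ (n : ℕ) (φ : (Fin n → Bool) → V) (hφ : IsCubeChart K.cubes φ),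
      Continuous (f ∘ K.charMap φ hφ)) : Continuous f := by
  refine continuous_iSup_dom.2 fun n => continuous_iSup_dom.2 fun φ => continuous_iSup_dom.2
    fun hφ => continuous_coinduced_dom.2 (h n φ hφ)

theorem continuous_weight (v : V) : Continuous fun x : K.Realization => x.1 v :=
  continuous_realization_dom fun _ φ _ => continuous_cubePoint_apply φ v

instance {n : ℕ} : LocallyPathConnectedSpace (Fin n → unitInterval) := by
  have : LocallyPathConnectedSpace unitInterval :=
    (convex_Icc (0 : ℝ) 1).locallyPathConnectedSpace
  infer_instance

/-- The realization is a quotient of a disjoint union of cubes, and local path connectedness passes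
to quotients. -/
instance locallyPathConnectedSpace_realization : LocallyPathConnectedSpace K.Realization := by
  let ι := Σ n : ℕ, {φ : (Fin n → Bool) → V // IsCubeChart K.cubes φ}
  let q : (Σ i : ι, (Fin i.1 → unitInterval)) → K.Realization :=
    fun p => K.charMap p.1.2.1 p.1.2.2 p.2
  have : (inferInstance : TopologicalSpace K.Realization) =
      TopologicalSpace.coinduced q inferInstance := by
    apply le_antisymm
    · refine iSup_le fun n => iSup_le fun φ => iSup_le fun hφ => ?_
      rw [← continuous_iff_coinduced_le]
      exact @Continuous.comp _ _ _ _ _ (TopologicalSpace.coinduced q inferInstance) _ q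
        continuous_coinduced_rng
        (continuous_sigmaMk (σ := fun i : ι => (Fin i.1 → unitInterval)) (i := ⟨n, φ, hφ⟩))
    · rw [← continuous_iff_coinduced_le]
      exact continuous_sigma fun i => continuous_charMap i.2.2
  have h := LocallyPathConnectedSpace.coinduced q
  rw [← this] at h
  exact h

end CubeComplex

/-- Change the `i`-th coordinate of a vertex of the standard cube. -/
def flipAt {n : ℕ} (i : Fin n) (ε : Fin n → Bool) : Fin n → Bool := Function.update ε i (!ε i)

/-! ### Combinatorics of the vertices of the standard cube -/

section flipAt

variable {n : ℕ} {i j : Fin n} {ε : Fin n → Bool}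

theorem flipAt_self : flipAt i ε i = !ε i := by simp [flipAt]

theorem flipAt_of_ne (h : j ≠ i) : flipAt i ε j = ε j := by simp [flipAt, h]

theorem flipAt_flipAt : flipAt i (flipAt i ε) = ε := by simp [flipAt]

theorem flipAt_comm : flipAt i (flipAt j ε) = flipAt j (flipAt i ε) := by
  funext k
  by_cases hij : i = j
  · subst hij; rfl
  by_cases hi : k = i
  · subst hi; rw [flipAt_self, flipAt_of_ne hij, flipAt_of_ne hij, flipAt_self]
  · by_cases hj : k = j
    · subst hj; rw [flipAt_of_ne hi, flipAt_self, flipAt_self, flipAt_of_ne hi]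
    · rw [flipAt_of_ne hi, flipAt_of_ne hj, flipAt_of_ne hj, flipAt_of_ne hi]

theorem flipAt_ne : flipAt i ε ≠ ε := fun h => by
  have := congrFun h i
  rw [flipAt_self] at this
  cases hε : ε i <;> simp [hε] at this

theorem flipAt_inj : flipAt i ε = flipAt j ε ↔ i = j := by
  refine ⟨fun h => by_contra fun hij => ?_, fun h => by rw [h]⟩
  have := congrFun h i
  rw [flipAt_self, flipAt_of_ne hij] at this
  cases hε : ε i <;> simp [hε] at this

theorem flipAt_flipAt_ne (h : i ≠ j) : flipAt j (flipAt i ε) ≠ ε := fun hc => by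
  have := congrArg (flipAt j) hc
  rw [flipAt_flipAt, flipAt_inj] at this
  exact h this

/-- Vertices of the standard cube are joined by flipping coordinates one at a time. -/
theorem cube_induction {P : (Fin n → Bool) → Prop} (ε₀ : Fin n → Bool) (h₀ : P ε₀)
    (hflip : ∀ i ε, P ε → P (flipAt i ε)) (ε : Fin n → Bool) : P ε := by
  classical
  have key : ∀ s : Finset (Fin n), P (fun i => if i ∈ s then ε i else ε₀ i) := by
    intro s
    induction s using Finset.induction_on with
    | empty => simpa using h₀
    | insert j s hj ih =>
      by_cases h : ε j = ε₀ j
      · convert ih using 2 with i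
        by_cases hi : i = j
        · subst hi; simp [hj, h]
        · simp [hi]
      · convert hflip j _ ih using 1
        funext i
        by_cases hi : i = j
        · subst hi
          rw [flipAt_self]
          simp only [Finset.mem_insert_self, if_true, hj, if_false]
          cases h1 : ε i <;> cases h2 : ε₀ i <;> simp_all
        · rw [flipAt_of_ne hi]; simp [hi]
  simpa using key Finset.univ

end flipAt

namespace CubeComplex

variable {V : Type*} {K : CubeComplex V}

/-! ### Charts, edges and squares -/

section chart

variable {n : ℕ} {φ : (Fin n → Bool) → V}

theorem _root_.IsCubeChart.image_face_mem (hφ : IsCubeChart K.cubes φ) (I : Set (Fin n))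
    (a : Fin n → Bool) : φ '' {ε | ∀ i ∈ I, ε i = a i} ∈ K.cubes :=
  (hφ.2.2 _ (Set.image_subset_range _ _)).2 ⟨I, a, rfl⟩

theorem _root_.IsCubeChart.adj_flipAt (hφ : IsCubeChart K.cubes φ) (i : Fin n)
    (ε : Fin n → Bool) : K.graph.Adj (φ ε) (φ (flipAt i ε)) := by
  refine ⟨fun h => flipAt_ne (hφ.1 h).symm, ?_⟩
  convert hφ.image_face_mem {i}ᶜ ε
  ext v
  constructor
  · rintro (rfl | rfl)
    · exact ⟨ε, fun _ _ => rfl, rfl⟩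
    · exact ⟨_, fun j hj => flipAt_of_ne hj, rfl⟩
  · rintro ⟨η, hη, rfl⟩
    by_cases h : η i = ε i
    · left
      congr 1
      funext j
      by_cases hj : j = i
      · rw [hj, h]
      · exact hη j hj
    · right
      congr 1
      funext j
      by_cases hj : j = i
      · rw [hj, flipAt_self]
        cases h1 : η i <;> cases h2 : ε i <;> simp_all
      · rw [flipAt_of_ne hj]; exact hη j hj

/-- An edge is a face, and its two vertices differ in some free coordinate. Flipping that coordinate
stays in the face, which has no third vertex. -/
theorem _root_.IsCubeChart.exists_flipAt_of_adj (hφ : IsCubeChart K.cubes φ)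
    {ε η : Fin n → Bool} (h : K.graph.Adj (φ ε) (φ η)) : ∃ i, η = flipAt i ε := by
  obtain ⟨hne, hmem⟩ := h
  have hsub : ({φ ε, φ η} : Set V) ⊆ Set.range φ := by
    rintro _ (rfl | rfl) <;> exact ⟨_, rfl⟩
  obtain ⟨I, a, hIa⟩ := (hφ.2.2 _ hsub).1 hmem
  have hε : ∀ i ∈ I, ε i = a i := by
    have : φ ε ∈ φ '' {ε | ∀ i ∈ I, ε i = a i} := hIa ▸ Or.inl rfl
    exact (hφ.1.mem_set_image).1 this
  have hη : ∀ i ∈ I, η i = a i := by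
    have : φ η ∈ φ '' {ε | ∀ i ∈ I, ε i = a i} := hIa ▸ Or.inr rfl
    exact (hφ.1.mem_set_image).1 this
  have : ∃ i, ε i ≠ η i := by
    by_contra! hc
    exact hne (congrArg φ (funext hc))
  obtain ⟨i, hi⟩ := this
  have hiI : i ∉ I := fun h => hi ((hε i h).trans (hη i h).symm)
  have hf : φ (flipAt i ε) ∈ ({φ ε, φ η} : Set V) := by
    rw [hIa]
    refine ⟨_, fun j hj => ?_, rfl⟩
    rw [flipAt_of_ne (by rintro rfl; exact hiI hj)]
    exact hε j hj
  rcases hf with hf | hf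
  · exact absurd (hφ.1 hf) flipAt_ne
  · exact ⟨i, (hφ.1 hf).symm⟩

/-- Charts may be reparametrized by permuting and reflecting coordinates. -/
theorem _root_.IsCubeChart.reparam {cubes : Set (Set V)} (hφ : IsCubeChart cubes φ) {m : ℕ}
    (σ : Fin m ≃ Fin n) (δ : Fin n → Bool) :
    IsCubeChart cubes fun η : Fin m → Bool => φ fun k => xor (δ k) (η (σ.symm k)) := by
  have hr : (Set.range fun η : Fin m → Bool => φ fun k => xor (δ k) (η (σ.symm k))) =
      Set.range φ := by
    ext v
    constructor
    · rintro ⟨η, rfl⟩; exact ⟨_, rfl⟩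
    · rintro ⟨ε, rfl⟩
      exact ⟨fun i => xor (δ (σ i)) (ε (σ i)), by simp⟩
  refine ⟨fun η η' h => ?_, hr ▸ hφ.2.1, fun t ht => ?_⟩
  · funext i
    have := congrFun (hφ.1 h) (σ i)
    simpa using this
  · rw [hr] at ht
    rw [hφ.2.2 t ht]
    constructor
    · rintro ⟨I, a, rfl⟩
      refine ⟨{i | σ i ∈ I}, fun i => xor (δ (σ i)) (a (σ i)), ?_⟩
      ext v
      constructor
      · rintro ⟨ε, hε, rfl⟩
        refine ⟨fun i => xor (δ (σ i)) (ε (σ i)), fun i hi => by simp [hε (σ i) hi], ?_⟩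
        simp
      · rintro ⟨η, hη, rfl⟩
        refine ⟨_, fun k hk => ?_, rfl⟩
        have := hη (σ.symm k) (by simpa using hk)
        simp only [Equiv.apply_symm_apply] at this
        simp [this]
    · rintro ⟨I, a, rfl⟩
      refine ⟨{k | σ.symm k ∈ I}, fun k => xor (δ k) (a (σ.symm k)), ?_⟩
      ext v
      constructor
      · rintro ⟨η, hη, rfl⟩
        exact ⟨_, fun k hk => by simp [hη _ hk], rfl⟩
      · rintro ⟨ε, hε, rfl⟩
        refine ⟨fun i => xor (δ (σ i)) (ε (σ i)), fun i hi => ?_, by simp⟩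
        have := hε (σ i) (by simpa using hi)
        simp [this]

end chart

/-- The vertices `a, b, c, d` are the consecutive vertices of a `2`-cube. -/
structure IsSquare (K : CubeComplex V) (a b c d : V) : Prop where
  exists_cube : ∃ C ∈ K.cubes, a ∈ C ∧ b ∈ C ∧ c ∈ C ∧ d ∈ C
  ab : K.graph.Adj a b
  bc : K.graph.Adj b c
  cd : K.graph.Adj c d
  da : K.graph.Adj d a
  ac : a ≠ c
  bd : b ≠ d

namespace IsSquare

variable {a b c d : V}

theorem rotate (h : K.IsSquare a b c d) : K.IsSquare b c d a := by
  obtain ⟨C, hC, h1, h2, h3, h4⟩ := h.exists_cube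
  exact ⟨⟨C, hC, h2, h3, h4, h1⟩, h.bc, h.cd, h.da, h.ab, h.bd, h.ac.symm⟩

theorem reflect (h : K.IsSquare a b c d) : K.IsSquare a d c b := by
  obtain ⟨C, hC, h1, h2, h3, h4⟩ := h.exists_cube
  exact ⟨⟨C, hC, h1, h4, h3, h2⟩, h.da.symm, h.cd.symm, h.bc.symm, h.ab.symm, h.ac, h.bd.symm⟩

end IsSquare

theorem _root_.IsCubeChart.isSquare {n : ℕ} {φ : (Fin n → Bool) → V}
    (hφ : IsCubeChart K.cubes φ) {i j : Fin n} (hij : i ≠ j) (ε : Fin n → Bool) :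
    K.IsSquare (φ ε) (φ (flipAt i ε)) (φ (flipAt j (flipAt i ε))) (φ (flipAt j ε)) := by
  refine ⟨⟨Set.range φ, hφ.2.1, ⟨_, rfl⟩, ⟨_, rfl⟩, ⟨_, rfl⟩, ⟨_, rfl⟩⟩, hφ.adj_flipAt i ε,
    hφ.adj_flipAt j _, ?_, (hφ.adj_flipAt j ε).symm, fun h => ?_, fun h => ?_⟩
  · rw [flipAt_comm]; exact (hφ.adj_flipAt i _).symm
  · exact flipAt_flipAt_ne hij (hφ.1 h).symm
  · exact hij (flipAt_inj.1 (hφ.1 h))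

theorem IsSquare.eq_flipAt {n : ℕ} {φ : (Fin n → Bool) → V}
    (hφ : IsCubeChart K.cubes φ) {ε : Fin n → Bool} {i j : Fin n} {c : V}
    (h : K.IsSquare (φ ε) (φ (flipAt i ε)) c (φ (flipAt j ε))) (hc : c ∈ Set.range φ) :
    i ≠ j ∧ c = φ (flipAt j (flipAt i ε)) := by
  obtain ⟨η, rfl⟩ := hc
  have hij : i ≠ j := fun hij => h.bd (by rw [hij])
  refine ⟨hij, ?_⟩
  obtain ⟨k, hk⟩ := hφ.exists_flipAt_of_adj h.bc
  obtain ⟨l, hl⟩ := hφ.exists_flipAt_of_adj h.cd.symm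
  by_cases hkj : k = j
  · rw [hk, hkj]
  exfalso
  have hlj : l ≠ j := fun hlj => h.ac (by rw [hl, hlj, flipAt_flipAt])
  have := congrFun (hk.symm.trans hl) j
  rw [flipAt_of_ne (Ne.symm hkj), flipAt_of_ne hij.symm, flipAt_of_ne hlj.symm, flipAt_self] at this
  cases hε : ε j <;> simp [hε] at this

theorem IsSquare.exists_flipAt {n : ℕ} {φ : (Fin n → Bool) → V} (hφ : IsCubeChart K.cubes φ)
    {a b c d : V} (h : K.IsSquare a b c d) (ha : a ∈ Set.range φ) (hb : b ∈ Set.range φ)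
    (hd : d ∈ Set.range φ) : ∃ (ε : Fin n → Bool) (i j : Fin n), i ≠ j ∧ a = φ ε ∧
      b = φ (flipAt i ε) ∧ d = φ (flipAt j ε) := by
  obtain ⟨ε, rfl⟩ := ha
  obtain ⟨β, rfl⟩ := hb
  obtain ⟨δ, rfl⟩ := hd
  obtain ⟨i, rfl⟩ := hφ.exists_flipAt_of_adj h.ab
  obtain ⟨j, rfl⟩ := hφ.exists_flipAt_of_adj h.da.symm
  exact ⟨ε, i, j, fun hij => h.bd (by rw [hij]), rfl, rfl, rfl⟩

/-- Two `2`-cubes sharing two consecutive edges coincide. -/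
theorem IsSquare.unique {a b c c' d : V} (h : K.IsSquare a b c d) (h' : K.IsSquare a b c' d) :
    c = c' := by
  obtain ⟨C, hC, h1, h2, h3, h4⟩ := h.exists_cube
  obtain ⟨C', hC', h1', h2', h3', h4'⟩ := h'.exists_cube
  have key : ∀ D ∈ K.cubes, ∀ x, K.IsSquare a b x d → a ∈ D → b ∈ D → x ∈ D → d ∈ D →
      ∀ y, K.IsSquare a b y d → y ∈ D → y = x := by
    intro D hD x hx hax hbx hxD hdx y hy hyD
    obtain ⟨n, φ, hφ, rfl⟩ := K.exists_chart D hD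
    obtain ⟨ε, i, j, hij, rfl, rfl, rfl⟩ := hx.exists_flipAt hφ hax hbx hdx
    rw [(hx.eq_flipAt hφ hxD).2, (hy.eq_flipAt hφ hyD).2]
  -- The intersection of the two cubes is a cube containing `a`, `b`, `d`. It therefore contains a
  -- fourth vertex completing them to a square, which must agree with both `c` and `c'`.
  obtain ⟨n, φ, hφ, hr⟩ := K.exists_chart _ (K.inter_mem C hC C' hC' ⟨a, h1, h1'⟩)
  obtain ⟨ε, i, j, hij, rfl, rfl, rfl⟩ := h.exists_flipAt hφ (hr ▸ ⟨h1, h1'⟩) (hr ▸ ⟨h2, h2'⟩)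
    (hr ▸ ⟨h4, h4'⟩)
  have hs := hφ.isSquare hij ε
  have hm : φ (flipAt j (flipAt i ε)) ∈ C ∩ C' := hr ▸ ⟨_, rfl⟩
  exact (key C hC c h h1 h2 h3 h4 _ hs hm.1).symm.trans (key C' hC' c' h' h1' h2' h3' h4' _ hs hm.2)

/-- Three `2`-cubes pairwise sharing edges at a vertex span a `3`-cube. -/
theorem IsSquare.exists_cube_corner {v x y z xy xz yz : V} (hK : K.LinkIsFlag v)
    (hxy : K.IsSquare v x xy y) (hxz : K.IsSquare v x xz z) (hyz : K.IsSquare v y yz z) :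
    ∃ w, K.IsSquare x xy w xz ∧ K.IsSquare y xy w yz ∧ K.IsSquare z xz w yz := by
  have pair : ∀ {a b c : V}, K.IsSquare v a c b → {a, b} ∈ K.link v := by
    intro a b c h
    obtain ⟨C, hC, h1, h2, h3, h4⟩ := h.exists_cube
    refine ⟨Set.toFinite _, ?_, C, hC, h1, ?_⟩
    · rintro u (rfl | rfl)
      exacts [h.ab, h.da.symm]
    · rintro u (rfl | rfl) <;> assumption
  -- The squares make `x`, `y`, `z` pairwise adjacent in the link of `v`, so flagness yields a cube
  -- containing all four. There `w` is obtained from `v` by flipping three coordinates.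
  obtain ⟨-, -, C, hC, hv, hS⟩ := hK {x, y, z} (Set.toFinite _)
    (by rintro u (rfl | rfl | rfl); exacts [hxy.ab, hxy.da.symm, hxz.da.symm])
    (by
      rintro a (rfl | rfl | rfl) b (rfl | rfl | rfl) hab
      all_goals first
        | exact absurd rfl hab
        | exact pair hxy
        | exact pair hxz
        | exact pair hyz
        | exact pair hxy.reflect
        | exact pair hxz.reflect
        | exact pair hyz.reflect)
  obtain ⟨n, φ, hφ, rfl⟩ := K.exists_chart C hC
  have hx : x ∈ Set.range φ := hS (by simp)
  have hy : y ∈ Set.range φ := hS (by simp)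
  have hz : z ∈ Set.range φ := hS (by simp)
  obtain ⟨ε, i, j, hij, rfl, rfl, rfl⟩ := hxy.exists_flipAt hφ hv hx hy
  obtain ⟨ζ, rfl⟩ := hz
  obtain ⟨k, rfl⟩ := hφ.exists_flipAt_of_adj hxz.da.symm
  have hik : i ≠ k := fun h => hxz.bd (by rw [h])
  have hjk : j ≠ k := fun h => hyz.bd (by rw [h])
  obtain rfl := hxy.unique (hφ.isSquare hij ε)
  obtain rfl := hxz.unique (hφ.isSquare hik ε)
  obtain rfl := hyz.unique (hφ.isSquare hjk ε)
  refine ⟨φ (flipAt k (flipAt j (flipAt i ε))), hφ.isSquare hjk _, ?_, ?_⟩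
  · have := hφ.isSquare hik (flipAt j ε)
    rwa [flipAt_comm (i := i)] at this
  · have := hφ.isSquare hij (flipAt k ε)
    rwa [flipAt_comm (i := i), flipAt_comm (i := j), flipAt_comm (i := j) (j := k)] at this

/-- The cube witnessing a square may have large dimension, whereas `Opposite` asks for a
2-dimensional chart. One is found by charting the face with free coordinates `i`, `j` and moving `a`
to the origin. -/
theorem IsSquare.opposite {a b c d : V} (h : K.IsSquare a b c d) :
    K.Opposite s(a, b) s(d, c) := by
  obtain ⟨C, hC, h1, h2, h3, h4⟩ := h.exists_cube
  obtain ⟨n, φ, hφ, rfl⟩ := K.exists_chart C hC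
  obtain ⟨ε, i, j, hij, rfl, rfl, rfl⟩ := h.exists_flipAt hφ h1 h2 h4
  obtain ⟨-, rfl⟩ := h.eq_flipAt hφ h3
  obtain ⟨m, ψ, hψ, hr⟩ := K.exists_chart _ (hφ.image_face_mem {i, j}ᶜ ε)
  have hmem : ∀ {η}, φ η ∈ Set.range ψ ↔ ∀ k, k ≠ i → k ≠ j → η k = ε k := by
    intro η
    rw [hr, hφ.1.mem_set_image]
    simp
  obtain ⟨ε', i', j', hij', ha, hb, hd⟩ := h.exists_flipAt hψ (hmem.2 fun _ _ _ => rfl)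
    (hmem.2 fun _ h _ => flipAt_of_ne h) (hmem.2 fun _ _ h => flipAt_of_ne h)
  have hcm : φ (flipAt j (flipAt i ε)) ∈ Set.range ψ :=
    hmem.2 fun _ h h' => by rw [flipAt_of_ne h', flipAt_of_ne h]
  have hc : φ (flipAt j (flipAt i ε)) = ψ (flipAt j' (flipAt i' ε')) := by
    rw [ha, hb, hd] at h
    exact (h.eq_flipAt hψ hcm).2
  -- `ψ` has dimension two: the neighbours of `a` inside the face are only `b` and `d`.
  have hall : ∀ k, k = i' ∨ k = j' := by
    intro k
    have hk : ψ (flipAt k ε') ∈ Set.range ψ := ⟨_, rfl⟩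
    have hadj := hψ.adj_flipAt k ε'
    obtain ⟨η, hη, hηk⟩ := (hr ▸ hk : ψ (flipAt k ε') ∈ φ '' _)
    rw [← hηk, ← ha] at hadj
    obtain ⟨l, rfl⟩ := hφ.exists_flipAt_of_adj hadj
    by_cases hli : l = i
    · left
      rw [hli, hb] at hηk
      exact (flipAt_inj.1 (hψ.1 hηk)).symm
    · by_cases hlj : l = j
      · right
        rw [hlj, hd] at hηk
        exact (flipAt_inj.1 (hψ.1 hηk)).symm
      · have := hη l (by simp [hli, hlj])
        rw [flipAt_self] at this
        cases hε : ε l <;> simp [hε] at this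
  let σ : Fin 2 ≃ Fin m := Equiv.ofBijective ![i', j'] (by
    constructor
    · intro p q hpq
      fin_cases p <;> fin_cases q <;> simp_all
    · intro k
      rcases hall k with rfl | rfl
      exacts [⟨0, rfl⟩, ⟨1, rfl⟩])
  have hσi : σ.symm i' = 0 := by rw [Equiv.symm_apply_eq]; rfl
  have hσj : σ.symm j' = 1 := by rw [Equiv.symm_apply_eq]; rfl
  have e00 : (fun k => xor (ε' k) (![false, false] (σ.symm k))) = ε' := by
    funext k
    rcases hall k with rfl | rfl <;> simp [hσi, hσj]
  have e10 : (fun k => xor (ε' k) (![true, false] (σ.symm k))) = flipAt i' ε' := by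
    funext k
    rcases hall k with rfl | rfl
    · simp [hσi, flipAt_self]
    · simp [hσj, flipAt_of_ne hij'.symm]
  have e01 : (fun k => xor (ε' k) (![false, true] (σ.symm k))) = flipAt j' ε' := by
    funext k
    rcases hall k with rfl | rfl
    · simp [hσi, flipAt_of_ne hij']
    · simp [hσj, flipAt_self]
  have e11 : (fun k => xor (ε' k) (![true, true] (σ.symm k))) = flipAt j' (flipAt i' ε') := by
    funext k
    rcases hall k with rfl | rfl
    · simp [hσi, flipAt_of_ne hij', flipAt_self]
    · simp [hσj, flipAt_self, flipAt_of_ne hij'.symm]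
  refine ⟨_, hψ.reparam σ ε', ?_, ?_⟩
  · rw [e00, e10, ← ha, ← hb]
  · rw [e01, e11, ← hd, ← hc]

theorem Opposite.exists_isSquare {e f : Sym2 V} (h : K.Opposite e f) :
    ∃ a b c d, K.IsSquare a b c d ∧ e = s(a, b) ∧ f = s(d, c) := by
  obtain ⟨φ, hφ, rfl, rfl⟩ := h
  have h1 : flipAt 0 ![false, false] = ![true, false] := by decide
  have h2 : flipAt 1 ![true, false] = ![true, true] := by decide
  have h3 : flipAt 1 ![false, false] = ![false, true] := by decide
  have := hφ.isSquare (i := 0) (j := 1) (by decide) ![false, false]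
  rw [h1, h2, h3] at this
  exact ⟨_, _, _, _, this, rfl, rfl⟩

/-! ### Open stars of vertices -/

section cubePoint

variable {n : ℕ} {φ : (Fin n → Bool) → V}

theorem cubePoint_apply (hφ : Function.Injective φ) (t : Fin n → unitInterval)
    (ε : Fin n → Bool) :
    cubePoint φ t (φ ε) = ∏ i, (if ε i = true then (t i : ℝ) else 1 - (t i : ℝ)) := by
  unfold cubePoint
  rw [Finset.sum_eq_single ε]
  · simp
  · intro η _ hη
    rw [if_neg fun h => hη (hφ h)]
  · simp

theorem mem_range_of_cubePoint_ne_zero {t : Fin n → unitInterval} {v : V}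
    (h : cubePoint φ t v ≠ 0) : v ∈ Set.range φ := by
  unfold cubePoint at h
  obtain ⟨ε, -, hε⟩ := Finset.exists_ne_zero_of_sum_ne_zero h
  exact ⟨ε, by_contra fun hne => hε (if_neg hne)⟩

theorem cubePoint_vertex [DecidableEq V] (hφ : Function.Injective φ) (ε : Fin n → Bool) :
    cubePoint φ (fun i => if ε i = true then 1 else 0) = Pi.single (M := fun _ => ℝ) (φ ε) 1 := by
  funext v
  by_cases hv : v = φ ε
  · subst hv
    rw [cubePoint_apply hφ, Pi.single_eq_same]
    refine Finset.prod_eq_one fun i _ => ?_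
    by_cases h : ε i = true <;> simp [h]
  · rw [Pi.single_eq_of_ne hv]
    by_contra hne
    obtain ⟨η, rfl⟩ := mem_range_of_cubePoint_ne_zero hne
    rw [cubePoint_apply hφ] at hne
    have : ∃ i, η i ≠ ε i := by
      by_contra! hc
      exact hv (congrArg φ (funext hc))
    obtain ⟨i, hi⟩ := this
    refine hne (Finset.prod_eq_zero (Finset.mem_univ i) ?_)
    cases h1 : η i <;> cases h2 : ε i <;> simp_all

end cubePoint

/-- The open star of a vertex. -/
def openStar (K : CubeComplex V) (v : V) : Set K.Realization := {x | x.1 v ≠ 0}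

theorem isOpen_openStar (v : V) : IsOpen (K.openStar v) :=
  isOpen_ne.preimage (continuous_weight v)

theorem exists_mem_openStar (x : K.Realization) : ∃ v, x ∈ K.openStar v := by
  obtain ⟨_, n, φ, t, hφ, rfl⟩ := x
  refine ⟨φ fun i => decide ((t i : ℝ) ≠ 0), ?_⟩
  change cubePoint φ t _ ≠ 0
  rw [cubePoint_apply hφ.1, Finset.prod_ne_zero_iff]
  intro i _
  by_cases h : (t i : ℝ) = 0 <;> simp [h]

theorem exists_cube_of_mem_openStar (x : K.Realization) :
    ∃ C ∈ K.cubes, ∀ v, x ∈ K.openStar v → v ∈ C := by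
  obtain ⟨_, n, φ, t, hφ, rfl⟩ := x
  exact ⟨_, hφ.2.1, fun v hv => mem_range_of_cubePoint_ne_zero hv⟩

theorem exists_mem_openStar_of_mem_cube {C : Set V} (hC : C ∈ K.cubes) :
    ∃ x : K.Realization, ∀ v ∈ C, x ∈ K.openStar v := by
  obtain ⟨n, φ, hφ, rfl⟩ := K.exists_chart C hC
  refine ⟨K.charMap φ hφ fun _ => ⟨1 / 2, by norm_num, by norm_num⟩, ?_⟩
  rintro _ ⟨ε, rfl⟩
  change cubePoint φ _ _ ≠ 0
  rw [cubePoint_apply hφ.1, Finset.prod_ne_zero_iff]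
  intro i _
  by_cases h : ε i = true <;> (simp [h]; try norm_num)

/-- Inside each cube containing `v` the star is a product of half-open intervals, hence connected,
and all these pieces share the point `v`. -/
theorem isPreconnected_openStar (v : V) : IsPreconnected (K.openStar v) := by
  classical
  obtain ⟨n₀, φ₀, hφ₀, hr₀⟩ := K.exists_chart _ (K.singleton_mem v)
  obtain ⟨ε₀, h₀⟩ : v ∈ Set.range φ₀ := hr₀ ▸ rfl
  refine isPreconnected_of_forall
    (K.charMap φ₀ hφ₀ fun i => if ε₀ i = true then 1 else 0) fun y hy => ?_
  obtain ⟨_, n, φ, t, hφ, rfl⟩ := y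
  obtain ⟨ε, rfl⟩ := mem_range_of_cubePoint_ne_zero hy
  let A : Set (Fin n → unitInterval) :=
    Set.pi Set.univ fun i => if ε i = true then Set.Ioi 0 else Set.Iio 1
  have hA : ∀ t : Fin n → unitInterval, t ∈ A ↔ cubePoint φ t (φ ε) ≠ 0 := by
    intro t
    rw [cubePoint_apply hφ.1, Finset.prod_ne_zero_iff]
    simp only [A, Set.mem_univ_pi, Finset.mem_univ, true_imp_iff]
    refine forall_congr' fun i => ?_
    by_cases h : ε i = true
    · rw [if_pos h, if_pos h, Set.mem_Ioi, unitInterval.pos_iff_ne_zero, Ne, Ne, Set.Icc.coe_eq_zero]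
    · rw [if_neg h, if_neg h, Set.mem_Iio, unitInterval.lt_one_iff_ne_one, Ne, Ne, sub_eq_zero,
        eq_comm (a := (1 : ℝ)), Set.Icc.coe_eq_one]
  have hApre : IsPreconnected A := by
    refine isPreconnected_univ_pi fun i => ?_
    split_ifs
    · exact isPreconnected_Ioi
    · exact isPreconnected_Iio
  refine ⟨K.charMap φ hφ '' A, ?_, ?_, ⟨t, (hA t).2 hy, rfl⟩,
    hApre.image _ (continuous_charMap hφ).continuousOn⟩
  · rintro _ ⟨t', ht', rfl⟩
    exact (hA t').1 ht'
  · refine ⟨fun i => if ε i = true then 1 else 0, (hA _).2 ?_, Subtype.ext ?_⟩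
    · rw [cubePoint_vertex hφ.1]; simp
    · change cubePoint φ _ = cubePoint φ₀ _
      rw [cubePoint_vertex hφ.1, cubePoint_vertex hφ₀.1, h₀]

/-! ### Connectedness of the `1`-skeleton -/

theorem reachable_of_mem_cube {C : Set V} (hC : C ∈ K.cubes) {u v : V} (hu : u ∈ C)
    (hv : v ∈ C) : K.graph.Reachable u v := by
  obtain ⟨n, φ, hφ, rfl⟩ := K.exists_chart C hC
  obtain ⟨ε, rfl⟩ := hu
  obtain ⟨η, rfl⟩ := hv
  exact cube_induction (P := fun η => K.graph.Reachable (φ ε) (φ η)) ε (.refl _)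
    (fun i ζ h => h.trans (hφ.adj_flipAt i ζ).reachable) η

/-- Vertices whose stars meet lie in a common cube, hence are joined by a path. A vertex not
reachable from `v₀` would thus split the realization into two disjoint nonempty open unions of
stars. -/
theorem graph_connected [SimplyConnectedSpace K.Realization] : K.graph.Connected := by
  obtain ⟨x₀⟩ : Nonempty K.Realization := inferInstance
  obtain ⟨v₀, hv₀⟩ := exists_mem_openStar x₀
  let A : Set K.Realization := ⋃ v ∈ {v | K.graph.Reachable v₀ v}, K.openStar v
  let B : Set K.Realization := ⋃ v ∈ {v | ¬ K.graph.Reachable v₀ v}, K.openStar v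
  have hA : IsOpen A := isOpen_biUnion fun v _ => isOpen_openStar v
  have hB : IsOpen B := isOpen_biUnion fun v _ => isOpen_openStar v
  have hreach : ∀ v, K.graph.Reachable v₀ v := by
    intro v
    by_contra hv
    obtain ⟨x₁, hx₁⟩ := exists_mem_openStar_of_mem_cube (K.singleton_mem v)
    obtain ⟨x, -, hxA, hxB⟩ := (isPreconnected_univ (α := K.Realization)) A B hA hB
      (fun x _ => by
        obtain ⟨w, hw⟩ := exists_mem_openStar x
        by_cases h : K.graph.Reachable v₀ w
        · exact Or.inl (Set.mem_biUnion (show w ∈ {v | K.graph.Reachable v₀ v} from h) hw)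
        · exact Or.inr (Set.mem_biUnion (show w ∈ {v | ¬ K.graph.Reachable v₀ v} from h) hw))
      ⟨x₀, trivial, Set.mem_biUnion (show v₀ ∈ {v | K.graph.Reachable v₀ v} from .refl _) hv₀⟩
      ⟨x₁, trivial, Set.mem_biUnion (show v ∈ {v | ¬ K.graph.Reachable v₀ v} from hv)
        (hx₁ v rfl)⟩
    obtain ⟨a, ha, hxa⟩ := Set.mem_iUnion₂.1 hxA
    obtain ⟨b, hb, hxb⟩ := Set.mem_iUnion₂.1 hxB
    obtain ⟨C, hC, hsub⟩ := exists_cube_of_mem_openStar x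
    exact hb (ha.trans (reachable_of_mem_cube hC (hsub a hxa) (hsub b hxb)))
  have : Nonempty V := ⟨v₀⟩
  exact ⟨fun u v => (hreach u).symm.trans (hreach v)⟩

/-! ### Local systems on the `2`-skeleton -/

/-- A family of transport maps along the edges, inverse to each other on opposite orientations of
an edge and compatible with the `2`-cubes. -/
structure IsTransport (K : CubeComplex V) {F : V → Type*} (t : ∀ u v, F u → F v) : Prop where
  inv : ∀ u v, K.graph.Adj u v → ∀ f, t v u (t u v f) = f
  square : ∀ a b c d, K.IsSquare a b c d → ∀ f, t b c (t a b f) = t d c (t a d f)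

/-- The family `s` is compatible with the transport along the edges between vertices of `C`. -/
def IsFlatOn (K : CubeComplex V) {F : V → Type*} (t : ∀ u v, F u → F v) (C : Set V)
    (s : ∀ v, F v) : Prop :=
  ∀ u ∈ C, ∀ v ∈ C, K.graph.Adj u v → t u v (s u) = s v

variable {F : V → Type*} {t : ∀ u v, F u → F v}

/-- The section is built one coordinate direction at a time. Values on the far side of a new
direction `j` are transported across it from the near side; `square` preserves flatness in the old
directions, and `inv` covers the new one traversed backwards. -/
theorem IsTransport.exists_flat_chart (ht : K.IsTransport t) [∀ v, Nonempty (F v)] {n : ℕ}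
    {φ : (Fin n → Bool) → V} (hφ : IsCubeChart K.cubes φ) (ε₀ : Fin n → Bool) (f : F (φ ε₀)) :
    ∃ s : ∀ ε, F (φ ε), s ε₀ = f ∧ ∀ ε i, t _ _ (s ε) = s (flipAt i ε) := by
  classical
  have key : ∀ S : Finset (Fin n), ∃ s : ∀ ε, F (φ ε), s ε₀ = f ∧
      ∀ ε, (∀ k ∉ S, ε k = ε₀ k) → ∀ i ∈ S, t _ _ (s ε) = s (flipAt i ε) := by
    intro S
    induction S using Finset.induction_on with
    | empty =>
      exact ⟨Function.update (fun ε => Classical.arbitrary (F (φ ε))) ε₀ f, by simp, by simp⟩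
    | insert j S hj ih =>
      obtain ⟨s, hs₀, hs⟩ := ih
      let s' : ∀ ε, F (φ ε) := fun ε =>
        if ε j = ε₀ j then s ε else t (φ (flipAt j ε)) (φ ε) (s (flipAt j ε))
      have hs1 : ∀ ε, ε j = ε₀ j → s' ε = s ε := fun ε h => if_pos h
      have hs2 : ∀ ε, ε j ≠ ε₀ j → s' ε = t (φ (flipAt j ε)) (φ ε) (s (flipAt j ε)) :=
        fun ε h => if_neg h
      have hflip : ∀ ε : Fin n → Bool, flipAt j ε j = ε₀ j ↔ ε j ≠ ε₀ j := by
        intro ε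
        rw [flipAt_self]
        cases ε j <;> cases ε₀ j <;> simp
      refine ⟨s', (hs1 _ rfl).trans hs₀, fun ε hε i hi => ?_⟩
      by_cases hεj : ε j = ε₀ j
      · rw [hs1 ε hεj]
        rcases Finset.mem_insert.1 hi with rfl | hi
        · rw [hs2 _ (by rw [Ne, hflip]; simpa using hεj), flipAt_flipAt]
        · have hij : j ≠ i := by rintro rfl; exact hj hi
          rw [hs1 _ (by rw [flipAt_of_ne hij, hεj])]
          refine hs ε (fun k hk => ?_) i hi
          by_cases hkj : k = j
          · rw [hkj, hεj]
          · exact hε k (by simp [hkj, hk])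
      · rw [hs2 ε hεj]
        rcases Finset.mem_insert.1 hi with rfl | hi
        · rw [hs1 _ ((hflip ε).2 hεj)]
          exact ht.inv _ _ (hφ.adj_flipAt _ _).symm _
        · have hij : j ≠ i := by rintro rfl; exact hj hi
          rw [hs2 _ (by rwa [flipAt_of_ne hij])]
          have h1 := hs (flipAt j ε) (fun k hk => by
            by_cases hkj : k = j
            · rw [hkj, (hflip ε).2 hεj]
            · rw [flipAt_of_ne hkj]; exact hε k (by simp [hkj, hk])) i hi
          have hsq := hφ.isSquare hij.symm ε
          rw [ht.square _ _ _ _ hsq.reflect.rotate.reflect, flipAt_comm, h1]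
  obtain ⟨s, hs₀, hs⟩ := key Finset.univ
  exact ⟨s, hs₀, fun ε i => hs ε (by simp) i (by simp)⟩

theorem IsTransport.exists_isFlatOn (ht : K.IsTransport t) [∀ v, Nonempty (F v)] {C : Set V}
    (hC : C ∈ K.cubes) {u : V} (hu : u ∈ C) (f : F u) :
    ∃ s : ∀ v, F v, s u = f ∧ K.IsFlatOn t C s := by
  classical
  obtain ⟨n, φ, hφ, rfl⟩ := K.exists_chart C hC
  obtain ⟨ε₀, rfl⟩ := hu
  obtain ⟨s, hs₀, hs⟩ := ht.exists_flat_chart hφ ε₀ f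
  let s' : ∀ v, F v := fun v =>
    if h : ∃ ε, φ ε = v then h.choose_spec ▸ s h.choose else Classical.arbitrary (F v)
  have hs' : ∀ ε, s' (φ ε) = s ε := by
    intro ε
    have h : ∃ η, φ η = φ ε := ⟨ε, rfl⟩
    have aux : ∀ η (e : φ η = φ ε), e ▸ s η = s ε := by
      intro η e
      obtain rfl := hφ.1 e
      rfl
    simp only [s', dif_pos h]
    exact aux _ _
  refine ⟨s', (hs' ε₀).trans hs₀, ?_⟩
  rintro _ ⟨ε, rfl⟩ _ ⟨η, rfl⟩ hadj
  obtain ⟨i, rfl⟩ := hφ.exists_flipAt_of_adj hadj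
  rw [hs', hs', hs]

theorem IsFlatOn.eq_of_eq {C : Set V} (hC : C ∈ K.cubes) {s s' : ∀ v, F v}
    (hs : K.IsFlatOn t C s) (hs' : K.IsFlatOn t C s') {u v : V} (hu : u ∈ C) (hv : v ∈ C)
    (h : s u = s' u) : s v = s' v := by
  obtain ⟨n, φ, hφ, rfl⟩ := K.exists_chart C hC
  obtain ⟨ε, rfl⟩ := hu
  obtain ⟨η, rfl⟩ := hv
  refine cube_induction (P := fun η => s (φ η) = s' (φ η)) ε h (fun i ζ hζ => ?_) η
  rw [← hs _ ⟨ζ, rfl⟩ _ ⟨_, rfl⟩ (hφ.adj_flipAt i ζ),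
    ← hs' _ ⟨ζ, rfl⟩ _ ⟨_, rfl⟩ (hφ.adj_flipAt i ζ), hζ]

theorem IsFlatOn.mono {C D : Set V} {s : ∀ v, F v} (hs : K.IsFlatOn t C s) (h : D ⊆ C) :
    K.IsFlatOn t D s := fun u hu v hv => hs u (h hu) v (h hv)

/-- Two cubes containing `u` and `v` intersect in a cube containing both, so the transport from `u`
to `v` does not depend on the cube. Pairs in no common cube receive an arbitrary value. -/
theorem IsTransport.exists_cube_transport (ht : K.IsTransport t) [∀ v, Nonempty (F v)] :
    ∃ T : ∀ u v, F u → F v, ∀ C ∈ K.cubes, ∀ s, K.IsFlatOn t C s → ∀ u ∈ C, ∀ v ∈ C,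
      T u v (s u) = s v := by
  classical
  have : ∀ u v (f : F u), ∃ g : F v, ∀ C ∈ K.cubes, ∀ s, K.IsFlatOn t C s → u ∈ C → v ∈ C →
      s u = f → g = s v := by
    intro u v f
    by_cases h : ∃ C ∈ K.cubes, u ∈ C ∧ v ∈ C
    · obtain ⟨C₀, hC₀, hu₀, hv₀⟩ := h
      obtain ⟨s₀, hs₀, hflat₀⟩ := ht.exists_isFlatOn hC₀ hu₀ f
      refine ⟨s₀ v, fun C hC s hs hu hv hsf => ?_⟩
      exact (hflat₀.mono Set.inter_subset_left).eq_of_eq (K.inter_mem C₀ hC₀ C hC ⟨u, hu₀, hu⟩)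
        (hs.mono Set.inter_subset_right) ⟨hu₀, hu⟩ ⟨hv₀, hv⟩ (hs₀.trans hsf.symm)
    · exact ⟨Classical.arbitrary _, fun C hC _ _ hu hv => absurd ⟨C, hC, hu, hv⟩ h⟩
  choose T hT using this
  exact ⟨T, fun C hC s hs u hu v hv => hT u v (s u) C hC s hs hu hv rfl⟩

theorem IsTransport.nonempty_equiv (ht : K.IsTransport t) {u v : V}
    (h : K.graph.Reachable u v) : Nonempty (F v ≃ F u) := by
  obtain ⟨p⟩ := h
  induction p with
  | nil => exact ⟨Equiv.refl _⟩
  | cons hadj _ ih =>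
    obtain ⟨e⟩ := ih
    exact ⟨e.trans ⟨t _ _, t _ _, ht.inv _ _ hadj.symm, ht.inv _ _ hadj⟩⟩

/-- On a simply connected cube complex, a transport along the edges compatible with the `2`-cubes
has a flat section through every point. -/
theorem IsTransport.exists_flat_section [SimplyConnectedSpace K.Realization]
    (ht : K.IsTransport t) (v₀ : V) (f₀ : F v₀) :
    ∃ s : ∀ v, F v, s v₀ = f₀ ∧ ∀ u v, K.graph.Adj u v → t u v (s u) = s v := by
  have hconn : K.graph.Connected := graph_connected
  have e : ∀ v, Nonempty (F v ≃ F v₀) := fun v => ht.nonempty_equiv (hconn v₀ v)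
  replace e := fun v => (e v).some
  have hne : ∀ v, Nonempty (F v) := fun v => ⟨(e v).symm f₀⟩
  obtain ⟨T, hT⟩ := ht.exists_cube_transport
  have hcube : ∀ u v w, (K.openStar u ∩ K.openStar v ∩ K.openStar w).Nonempty →
      ∃ C ∈ K.cubes, u ∈ C ∧ v ∈ C ∧ w ∈ C := by
    rintro u v w ⟨x, ⟨hu, hv⟩, hw⟩
    obtain ⟨C, hC, h⟩ := exists_cube_of_mem_openStar x
    exact ⟨C, hC, h u hu, h v hv, h w hw⟩
  -- The bijections `e` identify all fibres with `F v₀`, as the covering argument needs a constant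
  -- fibre. The cocycle condition holds because stars overlap only inside a common cube.
  obtain ⟨s, hs₀, hs⟩ := exists_flat_section_of_cover K.openStar isOpen_openStar
    isPreconnected_openStar exists_mem_openStar
    (fun u v f => e v (T u v ((e u).symm f)))
    (fun v hv f => by
      obtain ⟨s, hs, hflat⟩ := ht.exists_isFlatOn (K.singleton_mem v) rfl ((e v).symm f)
      rw [← hs, hT _ (K.singleton_mem v) s hflat v rfl v rfl, hs, Equiv.apply_symm_apply])
    (fun u v w hx f => by
      obtain ⟨C, hC, hu, hv, hw⟩ := hcube u v w hx
      obtain ⟨s, hs, hflat⟩ := ht.exists_isFlatOn hC hu ((e u).symm f)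
      rw [← hs, hT C hC s hflat u hu v hv, hT C hC s hflat u hu w hw, Equiv.symm_apply_apply,
        hT C hC s hflat v hv w hw])
    v₀ (by
      obtain ⟨x, hx⟩ := exists_mem_openStar_of_mem_cube (K.singleton_mem v₀)
      exact ⟨x, hx v₀ rfl⟩) (e v₀ f₀)
  refine ⟨fun v => (e v).symm (s v), by simp [hs₀], fun u v huv => ?_⟩
  obtain ⟨x, hx⟩ := exists_mem_openStar_of_mem_cube huv.2
  have h := hs u v ⟨x, hx u (Or.inl rfl), hx v (Or.inr rfl)⟩
  obtain ⟨s', hs', hflat⟩ := ht.exists_isFlatOn huv.2 (Or.inl rfl) ((e u).symm (s u))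
  dsimp only
  rw [← h, Equiv.symm_apply_apply, ← hs', hT _ huv.2 s' hflat u (Or.inl rfl) v (Or.inr rfl)]
  exact hflat u (Or.inl rfl) v (Or.inr rfl) huv

/-! ### Edge paths up to square moves

An edge path is recorded by the list of its vertices, starting with its endpoint. -/

/-- Two edge paths differ by replacing two consecutive edges of a `2`-cube by the opposite ones. -/
inductive SquareMove (K : CubeComplex V) : List V → List V → Prop
  | head {x y z y' : V} (l : List V) (h : K.IsSquare x y z y') :
      SquareMove K (x :: y :: z :: l) (x :: y' :: z :: l)
  | cons (a : V) {p q : List V} (h : SquareMove K p q) : SquareMove K (a :: p) (a :: q)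

/-- Two edge paths differ by a sequence of square moves. -/
def PathEquiv (K : CubeComplex V) : List V → List V → Prop := Relation.ReflTransGen K.SquareMove

theorem SquareMove.symm {p q : List V} (h : K.SquareMove p q) : K.SquareMove q p := by
  induction h with
  | head l h => exact .head l h.reflect
  | cons a _ ih => exact .cons a ih

theorem SquareMove.length_eq {p q : List V} (h : K.SquareMove p q) : p.length = q.length := by
  induction h with
  | head l h => rfl
  | cons a _ ih => simp [ih]

theorem SquareMove.exists_eq_cons {v : V} {l q : List V} (h : K.SquareMove (v :: l) q) :
    ∃ l', q = v :: l' := by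
  cases h with
  | head l h => exact ⟨_, rfl⟩
  | cons a h => exact ⟨_, rfl⟩

namespace PathEquiv

theorem refl (p : List V) : K.PathEquiv p p := Relation.ReflTransGen.refl

theorem symm {p q : List V} (h : K.PathEquiv p q) : K.PathEquiv q p := by
  induction h with
  | refl => exact .refl _
  | tail _ h ih => exact Relation.ReflTransGen.head h.symm ih

theorem trans {p q r : List V} (h : K.PathEquiv p q) (h' : K.PathEquiv q r) : K.PathEquiv p r :=
  Relation.ReflTransGen.trans h h'

theorem cons (a : V) {p q : List V} (h : K.PathEquiv p q) : K.PathEquiv (a :: p) (a :: q) := by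
  induction h with
  | refl => exact .refl _
  | tail _ h ih => exact ih.tail (.cons a h)

theorem square {x y z y' : V} (h : K.IsSquare x y z y') (l : List V) :
    K.PathEquiv (x :: y :: z :: l) (x :: y' :: z :: l) :=
  Relation.ReflTransGen.single (.head l h)

theorem length_eq {p q : List V} (h : K.PathEquiv p q) : p.length = q.length := by
  induction h with
  | refl => rfl
  | tail _ h ih => exact ih.trans h.length_eq

end PathEquiv

/-- The two ways in which the edge paths `u :: a :: l` and `u :: b :: l'` can be equivalent. -/
def Exchange (K : CubeComplex V) (u a : V) (l : List V) (b : V) (l' : List V) : Prop :=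
  (a = b ∧ K.PathEquiv (a :: l) (a :: l')) ∨
    ∃ c m, K.IsSquare u a c b ∧ K.PathEquiv (a :: l) (a :: c :: m) ∧
      K.PathEquiv (b :: l') (b :: c :: m)

/-- This is where flagness enters. The induction is on length and, inside, on the chain of moves. A
move away from the head is absorbed into the tails; a move at the head replaces `b` by `d`. If `a`
was already exchanged for `b`, the shorter path ending at `b` has two continuations `c` and `c'`,
and the induction hypothesis compares them. -/
theorem PathEquiv.exists_exchange (hK : ∀ v, K.LinkIsFlag v) (n : ℕ) :
    ∀ {p q : List V}, p.length = n → K.PathEquiv p q → ∀ {u a : V} {l : List V},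
      p = u :: a :: l → ∃ b l', q = u :: b :: l' ∧ K.Exchange u a l b l' := by
  induction n with
  | zero =>
    rintro p q hp - u a l rfl
    simp at hp
  | succ n IH =>
    intro p q hp hpq u a l hpl
    induction hpq with
    | refl => exact ⟨a, l, hpl, Or.inl ⟨rfl, .refl _⟩⟩
    | @tail q r hpq hqr ih =>
      obtain ⟨b, l', rfl, hex⟩ := ih
      have hlen : (b :: l').length = n := by
        have := PathEquiv.length_eq hpq
        simp only [List.length_cons] at this ⊢
        omega
      cases hqr with
      | @cons _ _ r' hmove =>
        obtain ⟨l'', rfl⟩ := hmove.exists_eq_cons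
        refine ⟨b, l'', rfl, ?_⟩
        rcases hex with ⟨rfl, h⟩ | ⟨c, m, hsq, h1, h2⟩
        · exact Or.inl ⟨rfl, h.tail hmove⟩
        · exact Or.inr ⟨c, m, hsq, h1, Relation.ReflTransGen.head hmove.symm h2⟩
      | @head _ _ c' d m' hsq' =>
        refine ⟨d, c' :: m', rfl, ?_⟩
        rcases hex with ⟨rfl, h⟩ | ⟨c, m, hsq, h1, h2⟩
        · exact Or.inr ⟨c', m', hsq', h, .refl _⟩
        · obtain ⟨c₁, m₁, heq, hex⟩ := IH hlen h2 rfl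
          obtain ⟨rfl, rfl⟩ : c = c₁ ∧ m = m₁ := by simpa using heq
          rcases hex with ⟨rfl, h3⟩ | ⟨e, k, hsq'', h3, h4⟩
          · left
            -- Both squares contain the edges from `b` to `u` and to `c`, so the second exchange
            -- undoes the first.
            obtain rfl := hsq.rotate.rotate.rotate.unique hsq'.rotate.reflect
            exact ⟨rfl, h1.trans (h3.symm.cons a)⟩
          · right
            -- Three squares meet pairwise along edges at `b`. In the 3-cube they span, the vertex
            -- `f` opposite to `b` completes the square on `u`, `a`, `d`.
            obtain ⟨f, hf1, hf2, hf3⟩ := IsSquare.exists_cube_corner (hK b)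
              hsq.rotate.rotate.rotate hsq'.rotate.reflect hsq''.reflect
            exact ⟨f, e :: k, hf1, h1.trans ((h4.cons a).trans (.square hf2.rotate.reflect k)),
              (h3.cons d).trans (.square hf3.rotate.reflect k)⟩

theorem PathEquiv.exchange (hK : ∀ v, K.LinkIsFlag v) {u a b : V} {l l' : List V}
    (h : K.PathEquiv (u :: a :: l) (u :: b :: l')) : K.Exchange u a l b l' := by
  obtain ⟨b', l'', heq, hex⟩ := h.exists_exchange hK _ rfl rfl
  obtain ⟨rfl, rfl⟩ : b = b' ∧ l' = l'' := by simpa using heq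
  exact hex

theorem PathEquiv.cancel (hK : ∀ v, K.LinkIsFlag v) {u a : V} {l l' : List V}
    (h : K.PathEquiv (u :: a :: l) (u :: a :: l')) : K.PathEquiv (a :: l) (a :: l') := by
  rcases h.exchange hK with ⟨-, h⟩ | ⟨c, m, hsq, -, -⟩
  · exact h
  · exact absurd rfl hsq.bd

/-- Edge paths from `x₀` that cannot be shortened: when building up the path, no edge leads back
along the last edge of an equivalent path. -/
inductive IsReduced (K : CubeComplex V) (x₀ : V) : List V → Prop
  | base : IsReduced K x₀ [x₀]
  | cons {u v : V} {l : List V} (hadj : K.graph.Adj u v) (hl : IsReduced K x₀ (u :: l))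
      (hv : ∀ m, ¬ K.PathEquiv (u :: l) (u :: v :: m)) : IsReduced K x₀ (v :: u :: l)

namespace IsReduced

variable {x₀ : V}

theorem tail {u v : V} {l : List V} (h : K.IsReduced x₀ (v :: u :: l)) :
    K.IsReduced x₀ (u :: l) := by
  cases h; assumption

theorem adj {u v : V} {l : List V} (h : K.IsReduced x₀ (v :: u :: l)) : K.graph.Adj u v := by
  cases h; assumption

theorem not_pathEquiv {u v : V} {l : List V} (h : K.IsReduced x₀ (v :: u :: l)) (m : List V) :
    ¬ K.PathEquiv (u :: l) (u :: v :: m) := by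
  cases h with
  | cons _ _ hv => exact hv m

/-- A backtrack in the new path can be pushed through the square to give one in the old path:
backtracking to `y'` becomes backtracking to `x`, and backtracking to `x` becomes backtracking to
`y`. -/
theorem of_squareMove (hK : ∀ v, K.LinkIsFlag v) {p q : List V} (h : K.SquareMove p q)
    (hp : K.IsReduced x₀ p) : K.IsReduced x₀ q := by
  induction h with
  | @head x y z y' l hsq =>
    have hyz := hp.tail
    refine .cons hsq.da (.cons hsq.cd hyz.tail ?_) ?_
    · intro m hm
      refine hp.not_pathEquiv (y' :: m) ((hm.cons y).trans ?_)
      exact .square hsq.rotate m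
    · intro m hm
      rcases hm.exchange hK with ⟨hzx, -⟩ | ⟨c, k, hc, h1, -⟩
      · exact hsq.ac hzx.symm
      · obtain rfl := hsq.rotate.rotate.rotate.reflect.unique hc
        exact hyz.not_pathEquiv k h1
  | @cons a p q h ih =>
    cases hp with
    | base => cases h
    | @cons u _ l hadj hl hv =>
      obtain ⟨l', rfl⟩ := h.exists_eq_cons
      exact .cons hadj (ih hl) fun m hm => hv m (Relation.ReflTransGen.head h hm)

theorem of_pathEquiv (hK : ∀ v, K.LinkIsFlag v) {p q : List V} (hp : K.IsReduced x₀ p)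
    (h : K.PathEquiv p q) : K.IsReduced x₀ q := by
  induction h with
  | refl => exact hp
  | tail _ h ih => exact of_squareMove hK h ih

end IsReduced

/-- The path `v :: l'` is the reduction of the path `v :: u :: l`. -/
def ReductionStep (K : CubeComplex V) (u v : V) (l l' : List V) : Prop :=
  K.PathEquiv (u :: l) (u :: v :: l') ∨
    (∀ m, ¬ K.PathEquiv (u :: l) (u :: v :: m)) ∧ K.PathEquiv (v :: l') (v :: u :: l)

namespace ReductionStep

variable {x₀ u v : V} {l l' m m' : List V}

theorem congr (hK : ∀ v, K.LinkIsFlag v) (h : K.ReductionStep u v l l')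
    (h' : K.ReductionStep u v m m') (hlm : K.PathEquiv (u :: l) (u :: m)) :
    K.PathEquiv (v :: l') (v :: m') := by
  rcases h with h | ⟨h, h1⟩ <;> rcases h' with h' | ⟨h', h1'⟩
  · exact ((h.symm.trans hlm).trans h').cancel hK
  · exact absurd (hlm.symm.trans h) (h' _)
  · exact absurd (hlm.trans h') (h _)
  · exact (h1.trans (hlm.cons v)).trans h1'.symm

theorem symm (hK : ∀ v, K.LinkIsFlag v) (hl : K.IsReduced x₀ (u :: l))
    (h : K.ReductionStep u v l l') : K.ReductionStep v u l' l := by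
  rcases h with h | ⟨-, h⟩
  · exact Or.inr ⟨(hl.of_pathEquiv hK h).not_pathEquiv, h⟩
  · exact Or.inl h

theorem exists_of_adj (hK : ∀ v, K.LinkIsFlag v) (hl : K.IsReduced x₀ (u :: l))
    (huv : K.graph.Adj u v) : ∃ l', K.IsReduced x₀ (v :: l') ∧ K.ReductionStep u v l l' := by
  by_cases h : ∃ m, K.PathEquiv (u :: l) (u :: v :: m)
  · obtain ⟨m, hm⟩ := h
    exact ⟨m, (hl.of_pathEquiv hK hm).tail, Or.inl hm⟩
  · push Not at h
    exact ⟨u :: l, .cons huv hl h, Or.inr ⟨h, .refl _⟩⟩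

theorem length (h : K.ReductionStep u v l l') :
    l.length = l'.length + 1 ∨ l'.length = l.length + 1 := by
  rcases h with h | ⟨-, h⟩
  · left; simpa using h.length_eq
  · right; simpa using h.length_eq

variable {a b c : V} {la lb : List V}

/-- This gives the square condition for the transport of reduced classes. If both steps shorten, the
exchange property supplies the common tail; if one does, the square itself supplies it; if neither
does, the steps on to `c` lengthen again. -/
theorem exists_square (hK : ∀ v, K.LinkIsFlag v) (hsq : K.IsSquare u a c b)
    (ha : K.ReductionStep u a l la) (hb : K.ReductionStep u b l lb) :
    ∃ lc, K.ReductionStep a c la lc ∧ K.ReductionStep b c lb lc := by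
  have mixed : ∀ {a b la lb}, K.IsSquare u a c b → K.PathEquiv (u :: l) (u :: a :: la) →
      (∀ m, ¬ K.PathEquiv (u :: l) (u :: b :: m)) → K.PathEquiv (b :: lb) (b :: u :: l) →
      K.ReductionStep a c la (a :: la) ∧ K.ReductionStep b c lb (a :: la) := by
    intro a b la lb hsq ha hb hb'
    refine ⟨Or.inr ⟨fun m hm => hb (c :: m) ?_, .refl _⟩, Or.inl ?_⟩
    · exact (ha.trans (hm.cons u)).trans (.square hsq m)
    · exact (hb'.trans (ha.cons b)).trans (.square hsq.rotate.rotate.rotate la)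
  have away : ∀ {a b la}, K.IsSquare u a c b → (∀ m, ¬ K.PathEquiv (u :: l) (u :: b :: m)) →
      K.PathEquiv (a :: la) (a :: u :: l) → ∀ m, ¬ K.PathEquiv (a :: la) (a :: c :: m) := by
    intro a b la hsq hb ha m hm
    rcases (ha.symm.trans hm).exchange hK with ⟨huc, -⟩ | ⟨x, k, hx, h1, -⟩
    · exact hsq.ac huc
    · obtain rfl := hsq.rotate.reflect.unique hx
      exact hb k h1
  rcases ha with ha | ⟨ha, ha'⟩ <;> rcases hb with hb | ⟨hb, hb'⟩
  · rcases (ha.symm.trans hb).exchange hK with ⟨hab, -⟩ | ⟨c', m, hsq', h1, h2⟩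
    · exact absurd hab hsq.bd
    · obtain rfl := hsq.unique hsq'
      exact ⟨m, Or.inl h1, Or.inl h2⟩
  · exact ⟨_, mixed hsq ha hb hb'⟩
  · exact ⟨_, (mixed hsq.reflect hb ha ha').symm⟩
  · refine ⟨a :: u :: l, Or.inr ⟨away hsq hb ha', ha'.symm.cons c⟩,
      Or.inr ⟨away hsq.reflect ha hb', ?_⟩⟩
    exact (PathEquiv.square hsq.rotate.rotate.reflect l).trans (hb'.symm.cons c)

end ReductionStep

/-! ### Reduced paths and the combinatorial metric -/

/-- Reduced edge paths from `x₀` to `v`, up to square moves. -/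
def reducedSetoid (K : CubeComplex V) (x₀ v : V) :
    Setoid {l : List V // K.IsReduced x₀ (v :: l)} where
  r l l' := K.PathEquiv (v :: l.1) (v :: l'.1)
  iseqv := ⟨fun _ => .refl _, fun h => h.symm, fun h h' => h.trans h'⟩

theorem exists_isReduced (hK : K.IsCAT0) (x₀ v : V) : ∃ l, K.IsReduced x₀ (v :: l) := by
  have := hK.simplyConnected
  obtain ⟨p⟩ := (graph_connected (K := K)) v x₀
  induction p with
  | nil => exact ⟨[], .base⟩
  | cons hadj _ ih =>
    obtain ⟨l, hl⟩ := ih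
    obtain ⟨l', hl', -⟩ := ReductionStep.exists_of_adj hK.linkIsFlag hl hadj.symm
    exact ⟨l', hl'⟩

/-- In a CAT(0) cube complex, reduced edge paths with the same endpoints are equivalent. -/
theorem IsReduced.pathEquiv (hK : K.IsCAT0) {x₀ v : V} {l l' : List V}
    (hl : K.IsReduced x₀ (v :: l)) (hl' : K.IsReduced x₀ (v :: l')) :
    K.PathEquiv (v :: l) (v :: l') := by
  classical
  have := hK.simplyConnected
  have hflag := hK.linkIsFlag
  have hstep : ∀ (u v : V) (l : {l : List V // K.IsReduced x₀ (u :: l)}),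
      ∃ l' : {l : List V // K.IsReduced x₀ (v :: l)},
        K.graph.Adj u v → K.ReductionStep u v l.1 l'.1 := by
    intro u v l
    by_cases h : K.graph.Adj u v
    · obtain ⟨l', h1, h2⟩ := ReductionStep.exists_of_adj hflag l.2 h
      exact ⟨⟨l', h1⟩, fun _ => h2⟩
    · obtain ⟨l', hl'⟩ := exists_isReduced hK x₀ v
      exact ⟨⟨l', hl'⟩, fun h' => absurd h' h⟩
  choose r hr using hstep
  let F : V → Type _ := fun v => Quotient (K.reducedSetoid x₀ v)
  let t : ∀ u v, F u → F v := fun u v q => Quotient.mk _ (r u v q.out)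
  have ht : ∀ u v, K.graph.Adj u v → ∀ (l : {l : List V // K.IsReduced x₀ (u :: l)})
      (l' : {l : List V // K.IsReduced x₀ (v :: l)}), K.ReductionStep u v l.1 l'.1 →
      t u v (Quotient.mk _ l) = Quotient.mk _ l' := by
    intro u v huv l l' h
    refine Quotient.sound ?_
    have h1 : K.PathEquiv (u :: (Quotient.mk (K.reducedSetoid x₀ u) l).out.1) (u :: l.1) :=
      Quotient.mk_out (s := K.reducedSetoid x₀ u) l
    exact (hr u v _ huv).congr hflag h h1
  have htr : K.IsTransport t := by
    constructor
    · intro u v huv q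
      induction q using Quotient.inductionOn with
      | h l =>
        rw [ht u v huv l _ (hr u v l huv)]
        exact ht v u huv.symm _ _ ((hr u v l huv).symm hflag l.2)
    · intro u a c b hsq q
      induction q using Quotient.inductionOn with
      | h l =>
        have ha := hr u a l hsq.ab
        have hb := hr u b l hsq.da.symm
        rw [ht u a hsq.ab l _ ha, ht u b hsq.da.symm l _ hb]
        obtain ⟨lc, h1, h2⟩ := ReductionStep.exists_square hflag hsq ha hb
        have h3 := hr a c (r u a l) hsq.bc
        have hlc : K.IsReduced x₀ (c :: lc) :=
          (r a c (r u a l)).2.of_pathEquiv hflag (h3.congr hflag h1 (.refl _))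
        rw [ht a c hsq.bc _ ⟨lc, hlc⟩ h1, ht b c hsq.cd.symm _ ⟨lc, hlc⟩ h2]
  -- Transporting the trivial class along a reduced path yields the class of that path, so every
  -- reduced path to `v` represents `s v`.
  obtain ⟨s, hs₀, hs⟩ := htr.exists_flat_section x₀ (Quotient.mk _ ⟨[], .base⟩)
  have key : ∀ p, K.IsReduced x₀ p → ∀ v l (h : K.IsReduced x₀ (v :: l)), p = v :: l →
      s v = Quotient.mk _ ⟨l, h⟩ := by
    intro p hp
    induction hp with
    | base =>
      intro v l h heq
      obtain ⟨rfl, rfl⟩ : x₀ = v ∧ [] = l := by simpa using heq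
      exact hs₀
    | @cons u w m hadj hm hw ih =>
      intro v l h heq
      obtain ⟨rfl, rfl⟩ : w = v ∧ u :: m = l := by simpa using heq
      rw [← hs u w hadj, ih u m hm rfl]
      exact ht u w hadj ⟨m, hm⟩ ⟨u :: m, h⟩ (Or.inr ⟨hw, .refl _⟩)
  have h := (key _ hl v l hl rfl).symm.trans (key _ hl' v l' hl' rfl)
  exact Quotient.exact h

theorem IsReduced.dist_le {x₀ v : V} {l : List V} (hl : K.IsReduced x₀ (v :: l)) :
    K.graph.dist x₀ v ≤ l.length := by
  have key : ∀ p, K.IsReduced x₀ p → ∀ v l, p = v :: l →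
      ∃ w : K.graph.Walk x₀ v, w.length = l.length := by
    intro p hp
    induction hp with
    | base =>
      intro v l heq
      obtain ⟨rfl, rfl⟩ : x₀ = v ∧ [] = l := by simpa using heq
      exact ⟨.nil, rfl⟩
    | @cons u w m hadj hm hw ih =>
      intro v l heq
      obtain ⟨rfl, rfl⟩ : w = v ∧ u :: m = l := by simpa using heq
      obtain ⟨q, hq⟩ := ih u m rfl
      exact ⟨q.concat hadj, by simp [hq]⟩
  obtain ⟨w, hw⟩ := key _ hl v l rfl
  exact hw ▸ SimpleGraph.dist_le w

theorem _root_.SimpleGraph.Connected.exists_adj_dist_eq {G : SimpleGraph V} (hG : G.Connected)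
    {x v : V} {n : ℕ} (h : G.dist x v = n + 1) : ∃ u, G.Adj u v ∧ G.dist x u = n := by
  obtain ⟨w, hw⟩ := hG.exists_walk_length_eq_dist v x
  rw [G.dist_comm, h] at hw
  cases w with
  | nil => simp at hw
  | @cons _ u _ hadj q =>
    refine ⟨u, hadj.symm, ?_⟩
    have h1 := SimpleGraph.dist_le q
    have h2 := hG.dist_triangle (u := x) (v := u) (w := v)
    have h3 : G.dist u v = 1 := SimpleGraph.dist_eq_one_iff_adj.2 hadj.symm
    rw [G.dist_comm] at h1
    simp only [SimpleGraph.Walk.length_cons] at hw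
    omega

theorem exists_isReduced_length_eq_dist (hK : K.IsCAT0) (x₀ : V) (n : ℕ) :
    ∀ v, K.graph.dist x₀ v = n → ∃ l, K.IsReduced x₀ (v :: l) ∧ l.length = n := by
  have := hK.simplyConnected
  have hconn : K.graph.Connected := graph_connected
  induction n with
  | zero =>
    intro v hv
    obtain rfl := hconn.dist_eq_zero_iff.1 hv
    exact ⟨[], .base, rfl⟩
  | succ n ih =>
    intro v hv
    obtain ⟨u, huv, hu⟩ := hconn.exists_adj_dist_eq hv
    obtain ⟨l, hl, hlen⟩ := ih u hu
    -- A backtrack would produce a reduced path to `v` shorter than its distance from `x₀`.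
    refine ⟨u :: l, .cons huv hl fun m hm => ?_, by simp [hlen]⟩
    have h1 := ((hl.of_pathEquiv hK.linkIsFlag hm).tail).dist_le
    have h2 := hm.length_eq
    simp only [List.length_cons] at h2
    omega

theorem IsReduced.length_eq (hK : K.IsCAT0) {x₀ v : V} {l : List V}
    (hl : K.IsReduced x₀ (v :: l)) : l.length = K.graph.dist x₀ v := by
  obtain ⟨l', hl', h⟩ := exists_isReduced_length_eq_dist hK x₀ _ v rfl
  have := (hl.pathEquiv hK hl').length_eq
  simp only [List.length_cons] at this
  omega

/-- The `1`-skeleton of a CAT(0) cube complex is bipartite. -/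
theorem IsCAT0.dist_of_adj (hK : K.IsCAT0) (x : V) {u v : V} (h : K.graph.Adj u v) :
    K.graph.dist x u = K.graph.dist x v + 1 ∨ K.graph.dist x v = K.graph.dist x u + 1 := by
  obtain ⟨l, hl⟩ := exists_isReduced hK x u
  obtain ⟨l', hl', hs⟩ := ReductionStep.exists_of_adj hK.linkIsFlag hl h
  rw [← hl.length_eq hK, ← hl'.length_eq hK]
  exact hs.length

/-- The quadrangle condition for the `1`-skeleton of a CAT(0) cube complex. -/
theorem IsCAT0.quadrangle (hK : K.IsCAT0) {x y a b : V} {n : ℕ} (ha : K.graph.Adj y a)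
    (hb : K.graph.Adj y b) (hab : a ≠ b) (hy : K.graph.dist x y = n + 1)
    (hxa : K.graph.dist x a = n) (hxb : K.graph.dist x b = n) :
    ∃ c, K.IsSquare y a c b ∧ K.graph.dist x c + 1 = n := by
  have hred : ∀ {a}, K.graph.Adj y a → K.graph.dist x a = n →
      ∃ l, K.IsReduced x (y :: a :: l) ∧ l.length = n := by
    intro a ha hxa
    obtain ⟨l, hl, hlen⟩ := exists_isReduced_length_eq_dist hK x n a hxa
    refine ⟨l, .cons ha.symm hl fun m hm => ?_, hlen⟩
    have h1 := ((hl.of_pathEquiv hK.linkIsFlag hm).tail).dist_le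
    have h2 := hm.length_eq
    simp only [List.length_cons] at h2
    omega
  obtain ⟨l, hl, hlen⟩ := hred ha hxa
  obtain ⟨l', hl', -⟩ := hred hb hxb
  -- The geodesics reaching `y` through `a` and through `b` are equivalent, so their final edges are
  -- exchanged across a square.
  rcases (hl.pathEquiv hK hl').exchange hK.linkIsFlag with ⟨h, -⟩ | ⟨c, m, hsq, h1, -⟩
  · exact absurd h hab
  · refine ⟨c, hsq, ?_⟩
    have h2 := ((hl.tail.of_pathEquiv hK.linkIsFlag h1).tail).length_eq hK
    have h3 := h1.length_eq
    simp only [List.length_cons] at h3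
    omega

/-! ### Intervals and halfspaces -/

theorem IsCAT0.connected (hK : K.IsCAT0) : K.graph.Connected := by
  have := hK.simplyConnected
  exact graph_connected

/-- If `y` is not between `x` and `z`, then some neighbour of `y` is closer to both. -/
theorem IsCAT0.exists_adj_closer (hK : K.IsCAT0) {x y : V} (n : ℕ) :
    ∀ z, K.graph.dist y z = n → K.graph.dist x z < K.graph.dist x y + n →
      ∃ t, K.graph.Adj y t ∧ K.graph.dist x t + 1 = K.graph.dist x y ∧
        K.graph.dist z t + 1 = n := by
  have hconn := hK.connected
  induction n with
  | zero =>
    intro z hz h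
    obtain rfl := hconn.dist_eq_zero_iff.1 hz
    omega
  | succ m ih =>
    intro z hz h
    have step : ∀ z₁, K.graph.Adj z₁ z → K.graph.dist y z₁ = m →
        K.graph.dist x z₁ < K.graph.dist x y + m →
        ∃ t, K.graph.Adj y t ∧ K.graph.dist x t + 1 = K.graph.dist x y ∧
          K.graph.dist z t + 1 = m + 1 := by
      intro z₁ hadj h1 h2
      obtain ⟨t, hyt, hxt, hzt⟩ := ih z₁ h1 h2
      refine ⟨t, hyt, hxt, ?_⟩
      have h3 := hconn.dist_triangle (u := z) (v := z₁) (w := t)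
      have h4 := hconn.dist_triangle (u := z) (v := t) (w := y)
      rw [SimpleGraph.dist_eq_one_iff_adj.2 hadj.symm] at h3
      rw [SimpleGraph.dist_eq_one_iff_adj.2 hyt.symm, K.graph.dist_comm, hz] at h4
      omega
    obtain ⟨z₁, hadj₁, hz₁⟩ := hconn.exists_adj_dist_eq hz
    by_cases hlt : K.graph.dist x z₁ < K.graph.dist x y + m
    · exact step z₁ hadj₁ hz₁ hlt
    have htri := hconn.dist_triangle (u := x) (v := y) (w := z₁)
    have hb := hK.dist_of_adj x hadj₁
    cases m with
    | zero =>
      obtain rfl := hconn.dist_eq_zero_iff.1 hz₁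
      exact ⟨z, hadj₁, by omega, by simp⟩
    | succ m' =>
      obtain ⟨z₂, hadj₂, hz₂⟩ := hconn.exists_adj_dist_eq hz₁
      have hb₂ := hK.dist_of_adj x hadj₂
      have htri₂ := hconn.dist_triangle (u := x) (v := y) (w := z₂)
      -- Now `y` is between `x` and `z₁`, so `z` and `z₂` are both closer to `x` than `z₁` is. The
      -- square cuts off this corner, and `q` can replace `z₁`.
      obtain ⟨q, hsq, hq⟩ := hK.quadrangle (x := x) (y := z₁) (a := z) (b := z₂)
        (n := K.graph.dist x z) hadj₁ hadj₂.symm (by rintro rfl; omega) (by omega) rfl (by omega)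
      have h5 := hK.dist_of_adj y hsq.bc
      have h6 := hK.dist_of_adj y hsq.cd
      exact step q hsq.bc.symm (by omega) (by omega)

/-- If `d` were on the side of `w`, the quadrangle condition at `a` seen from `w` would put `c`
closer to `w` than `b`. Then the condition at `b` seen from `v` would put `d` closer to `v` than
`a`, although it has to be farther. -/
theorem IsCAT0.isSquare_closer (hK : K.IsCAT0) {v w a b c d : V} (hvw : K.graph.Adj v w)
    (hsq : K.IsSquare a b c d) (ha : K.graph.dist v a < K.graph.dist w a)
    (hb : K.graph.dist w b < K.graph.dist v b) : K.graph.dist v d < K.graph.dist w d := by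
  have side : ∀ x, K.graph.dist v x = K.graph.dist w x + 1 ∨
      K.graph.dist w x = K.graph.dist v x + 1 := by
    intro x
    rw [K.graph.dist_comm (u := v), K.graph.dist_comm (u := w)]
    exact hK.dist_of_adj x hvw
  have hsa := side a
  have hsb := side b
  have hsc := side c
  have hsd := side d
  have vab := hK.dist_of_adj v hsq.ab
  have wab := hK.dist_of_adj w hsq.ab
  have vda := hK.dist_of_adj v hsq.da
  have wda := hK.dist_of_adj w hsq.da
  have vbc := hK.dist_of_adj v hsq.bc
  by_contra hd
  obtain ⟨c', hc', hwc⟩ := hK.quadrangle (x := w) (n := K.graph.dist v a) hsq.ab hsq.da.symm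
    hsq.bd (by omega) (by omega) (by omega)
  obtain rfl := hsq.unique hc'
  obtain ⟨e, he, hve⟩ := hK.quadrangle (x := v) (n := K.graph.dist v a) hsq.ab.symm hsq.bc
    hsq.ac (by omega) (by omega) (by omega)
  obtain rfl := hsq.rotate.reflect.unique he
  omega

/-- The `1`-cube `f` joins the two halfspaces determined by the edge from `v` to `w`. -/
def Crosses (K : CubeComplex V) (v w : V) (f : Sym2 V) : Prop :=
  ∃ a b, f = s(a, b) ∧ K.graph.Adj a b ∧ K.graph.dist v a < K.graph.dist w a ∧
    K.graph.dist w b < K.graph.dist v b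

theorem IsCAT0.crosses_of_isSquare (hK : K.IsCAT0) {v w a b c d : V} (hvw : K.graph.Adj v w)
    (hsq : K.IsSquare a b c d) (h : K.Crosses v w s(a, b)) : K.Crosses v w s(d, c) := by
  obtain ⟨a', b', heq, -, ha, hb⟩ := h
  rcases Sym2.eq_iff.1 heq with ⟨rfl, rfl⟩ | ⟨rfl, rfl⟩
  · exact ⟨d, c, rfl, hsq.cd.symm, hK.isSquare_closer hvw hsq ha hb,
      hK.isSquare_closer hvw.symm hsq.rotate.reflect hb ha⟩
  · exact ⟨c, d, Sym2.eq_swap, hsq.cd, hK.isSquare_closer hvw hsq.rotate.reflect ha hb,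
      hK.isSquare_closer hvw.symm hsq hb ha⟩

theorem IsCAT0.crosses_iff_of_eqvGen (hK : K.IsCAT0) {v w : V} (hvw : K.graph.Adj v w)
    {e f : Sym2 V} (h : Relation.EqvGen K.Opposite e f) :
    K.Crosses v w e ↔ K.Crosses v w f := by
  induction h with
  | rel e f h =>
    obtain ⟨a, b, c, d, hsq, rfl, rfl⟩ := h.exists_isSquare
    exact ⟨hK.crosses_of_isSquare hvw hsq,
      hK.crosses_of_isSquare hvw hsq.rotate.rotate.rotate.reflect⟩
  | refl => rfl
  | symm _ _ _ ih => exact ih.symm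
  | trans _ _ _ _ _ ih ih' => exact ih.trans ih'

/-- A `1`-cube joining the two halfspaces of an edge is dual to the same hyperplane. -/
theorem IsCAT0.eqvGen_of_closer (hK : K.IsCAT0) {v w : V} (hvw : K.graph.Adj v w) (n : ℕ) :
    ∀ a b, K.graph.dist v a = n → K.graph.Adj a b → K.graph.dist v a < K.graph.dist w a →
      K.graph.dist w b < K.graph.dist v b → Relation.EqvGen K.Opposite s(v, w) s(a, b) := by
  have hconn := hK.connected
  have side : ∀ x, K.graph.dist v x = K.graph.dist w x + 1 ∨
      K.graph.dist w x = K.graph.dist v x + 1 := by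
    intro x
    rw [K.graph.dist_comm (u := v), K.graph.dist_comm (u := w)]
    exact hK.dist_of_adj x hvw
  induction n with
  | zero =>
    intro a b hn hab ha hb
    obtain rfl := hconn.dist_eq_zero_iff.1 hn
    rw [SimpleGraph.dist_eq_one_iff_adj.2 hab] at hb
    obtain rfl := hconn.dist_eq_zero_iff.1 (Nat.lt_one_iff.1 hb)
    exact .refl _
  | succ n ih =>
    intro a b hn hab ha hb
    have hsa := side a
    have hsb := side b
    have vab := hK.dist_of_adj v hab
    have wab := hK.dist_of_adj w hab
    obtain ⟨t, htb, ht⟩ := hconn.exists_adj_dist_eq (x := w) (v := b) (n := n) (by omega)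
    have hst := side t
    have vtb := hK.dist_of_adj v htb
    -- The square on `b`, `t`, `c`, `a` slides the edge `ab` to the parallel edge `ct`, one step
    -- nearer to `v`.
    obtain ⟨c, hsq, hc⟩ := hK.quadrangle (x := v) (n := n + 1) htb.symm hab.symm
      (by rintro rfl; omega) (by omega) (by omega) hn
    have hsc := side c
    have wca := hK.dist_of_adj w hsq.cd
    refine (ih c t (by omega) hsq.bc.symm (by omega) (by omega)).trans _ _ _ (.rel _ _ ?_)
    exact hsq.rotate.rotate.reflect.opposite

/-- The complementary components of the hyperplane dual to an edge are contained in halfspaces. -/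
theorem IsCAT0.reachable_deleteEdges_iff (hK : K.IsCAT0) {v w : V} (hvw : K.graph.Adj v w)
    {x : V} : (K.graph.deleteEdges {f | Relation.EqvGen K.Opposite s(v, w) f}).Reachable v x ↔
      K.graph.dist v x < K.graph.dist w x := by
  have hconn := hK.connected
  have hvv : K.Crosses v w s(v, w) := ⟨v, w, rfl, hvw, by
    simp [SimpleGraph.dist_eq_one_iff_adj.2 hvw.symm], by
    simp [SimpleGraph.dist_eq_one_iff_adj.2 hvw]⟩
  have side : ∀ x, K.graph.dist v x = K.graph.dist w x + 1 ∨
      K.graph.dist w x = K.graph.dist v x + 1 := by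
    intro x
    rw [K.graph.dist_comm (u := v), K.graph.dist_comm (u := w)]
    exact hK.dist_of_adj x hvw
  constructor
  · rintro ⟨p⟩
    have key : ∀ {a b} (p : (K.graph.deleteEdges
        {f | Relation.EqvGen K.Opposite s(v, w) f}).Walk a b),
        K.graph.dist v a < K.graph.dist w a → K.graph.dist v b < K.graph.dist w b := by
      intro a b p
      induction p with
      | nil => exact id
      | @cons a b c hab _ ih =>
        intro ha
        refine ih ?_
        rw [SimpleGraph.deleteEdges_adj] at hab
        by_contra hb
        have := side b
        exact hab.2 (hK.eqvGen_of_closer hvw _ a b rfl hab.1 ha (by omega))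
    refine key p ?_
    simp [SimpleGraph.dist_eq_one_iff_adj.2 hvw.symm]
  · generalize hn : K.graph.dist v x = n
    induction n generalizing x with
    | zero =>
      intro _
      obtain rfl := hconn.dist_eq_zero_iff.1 hn
      exact .refl _
    | succ n ih =>
      intro hx
      obtain ⟨u, hux, hu⟩ := hconn.exists_adj_dist_eq hn
      have wux := hK.dist_of_adj w hux
      refine (ih hu (by omega)).trans (SimpleGraph.Adj.reachable ?_)
      rw [SimpleGraph.deleteEdges_adj]
      refine ⟨hux, fun hmem => ?_⟩
      -- Every dual edge crosses between the halfspaces, but both ends of this geodesic edge are on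
      -- the side of `v`.
      obtain ⟨a, b, heq, -, ha, hb⟩ := (hK.crosses_iff_of_eqvGen hvw hmem).1 hvv
      rcases Sym2.eq_iff.1 heq with ⟨rfl, rfl⟩ | ⟨rfl, rfl⟩ <;> omega

/-! ### Actions -/

section action

variable {G : Type*} [Group G] [MulAction G V]

theorem PreservedBy.isCubeChart_smul (hG : K.PreservedBy G) (g : G) {n : ℕ}
    {φ : (Fin n → Bool) → V} (hφ : IsCubeChart K.cubes φ) :
    IsCubeChart K.cubes fun ε => g • φ ε := by
  have hr : Set.range (fun ε => g • φ ε) = g • Set.range φ := (Set.smul_set_range ..).symm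
  have himg : ∀ s, (fun ε => g • φ ε) '' s = g • φ '' s := fun s => (Set.image_image _ _ s).symm
  refine ⟨(MulAction.injective g).comp hφ.1, hr ▸ hG g _ hφ.2.1, fun t ht => ?_⟩
  rw [hr] at ht
  have ht' : g⁻¹ • t ⊆ Set.range φ := Set.smul_set_subset_iff_subset_inv_smul_set.2 (by simpa)
  have h1 : t ∈ K.cubes ↔ g⁻¹ • t ∈ K.cubes :=
    ⟨hG g⁻¹ t, fun h => by simpa using hG g _ h⟩
  rw [h1, hφ.2.2 _ ht']
  simp only [himg, inv_smul_eq_iff]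

theorem PreservedBy.opposite_smul (hG : K.PreservedBy G) (g : G) {e f : Sym2 V}
    (h : Relation.EqvGen K.Opposite e f) :
    Relation.EqvGen K.Opposite (Sym2.map (fun v => g • v) e) (Sym2.map (fun v => g • v) f) := by
  induction h with
  | rel e f h =>
    obtain ⟨φ, hφ, rfl, rfl⟩ := h
    exact .rel _ _ ⟨_, hG.isCubeChart_smul g hφ, rfl, rfl⟩
  | refl => exact .refl _
  | symm _ _ _ ih => exact ih.symm
  | trans _ _ _ _ _ ih ih' => exact ih.trans _ _ _ ih'

theorem PreservedBy.adj_smul (hG : K.PreservedBy G) (g : G) {u v : V} (h : K.graph.Adj u v) :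
    K.graph.Adj (g • u) (g • v) := by
  refine ⟨fun he => h.1 (MulAction.injective g he), ?_⟩
  have := hG g _ h.2
  rwa [← Set.image_smul, Set.image_pair] at this

theorem PreservedBy.dist_smul (hG : K.PreservedBy G) (hconn : K.graph.Connected) (g : G)
    (u v : V) : K.graph.dist (g • u) (g • v) = K.graph.dist u v := by
  have key : ∀ (g : G) (u v : V), K.graph.dist (g • u) (g • v) ≤ K.graph.dist u v := by
    intro g u v
    obtain ⟨p, hp⟩ := hconn.exists_walk_length_eq_dist u v
    let f : K.graph →g K.graph := ⟨fun v => g • v, fun h => hG.adj_smul g h⟩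
    rw [← hp, ← p.length_map f]
    exact SimpleGraph.dist_le _
  refine le_antisymm (key g u v) ?_
  simpa using key g⁻¹ (g • u) (g • v)

/-- An element moving the edge from `v` to `w` to an edge crossing the same hyperplane in the
opposite direction inverts that hyperplane. -/
theorem WithoutInversions.not_inverted (hinv : K.WithoutInversions G) (hK : K.IsCAT0)
    (hG : K.PreservedBy G) {v w : V} (hvw : K.graph.Adj v w) (h : G)
    (hw : K.graph.dist v (h • w) < K.graph.dist w (h • w))
    (hv : K.graph.dist w (h • v) < K.graph.dist v (h • v)) : False := by
  let H : Set (Sym2 V) := {f | Relation.EqvGen K.Opposite s(v, w) f}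
  have hmap : ∀ a b : V, Sym2.map (fun v => h • v) s(a, b) = s(h • a, h • b) := fun _ _ => rfl
  have he : Relation.EqvGen K.Opposite s(v, w) (Sym2.map (fun v => h • v) s(v, w)) := by
    rw [hmap, Sym2.eq_swap (a := h • v)]
    exact hK.eqvGen_of_closer hvw _ _ _ rfl (hG.adj_smul h hvw.symm) hw hv
  have hcancel : ∀ (g : G) (f : Sym2 V),
      Sym2.map (fun v => g • v) (Sym2.map (fun v => g⁻¹ • v) f) = f := by
    intro g f
    induction f using Sym2.ind with
    | _ a b => simp
  have hH : Sym2.map (fun v => h • v) '' H = H := by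
    ext f
    constructor
    · rintro ⟨f, hf, rfl⟩
      exact he.trans _ _ _ (hG.opposite_smul h hf)
    · intro hf
      refine ⟨Sym2.map (fun v => h⁻¹ • v) f, ?_, hcancel h f⟩
      have h1 := hG.opposite_smul h⁻¹ he
      have h2 := hcancel h⁻¹ s(v, w)
      rw [inv_inv] at h2
      rw [h2] at h1
      exact h1.symm.trans _ _ _ (hG.opposite_smul h⁻¹ hf)
  let A := (K.graph.deleteEdges H).connectedComponentMk v
  -- Since `h` preserves the hyperplane, it must keep `v` in its own component, whereas `hv` places
  -- `h • v` on the side of `w`.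
  have hA := hinv H ⟨s(v, w), hvw, rfl⟩ h hH A.supp ⟨A, rfl⟩
  have hmem : h • v ∈ A.supp := by
    rw [← hA]
    exact Set.smul_mem_smul_set (SimpleGraph.ConnectedComponent.connectedComponentMk_mem)
  rw [SimpleGraph.ConnectedComponent.mem_supp_iff, SimpleGraph.ConnectedComponent.eq] at hmem
  have := (hK.reachable_deleteEdges_iff hvw).1 hmem.symm
  omega

/-- Vertices of minimal displacement are moved by powers of `g` along geodesics. -/
theorem WithoutInversions.dist_pow_smul (hinv : K.WithoutInversions G) (hK : K.IsCAT0)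
    (hG : K.PreservedBy G) (g : G) (δ : ℕ) (hδ : ∀ u : V, δ ≤ K.graph.dist u (g • u)) (n : ℕ) :
    ∀ v : V, K.graph.dist v (g • v) = δ → K.graph.dist v (g ^ n • v) = n * δ := by
  have hconn := hK.connected
  have hd := hG.dist_smul hconn
  have hle : ∀ n (v : V), K.graph.dist v (g • v) = δ → K.graph.dist v (g ^ n • v) ≤ n * δ := by
    intro n v hv
    induction n with
    | zero => simp
    | succ n ih =>
      have h1 := hconn.dist_triangle (u := v) (v := g ^ n • v) (w := g ^ (n + 1) • v)
      have h2 : K.graph.dist (g ^ n • v) (g ^ (n + 1) • v) = δ := by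
        rw [pow_succ, mul_smul, hd, hv]
      rw [add_mul, one_mul]
      omega
  induction n with
  | zero => simp
  | succ n ih =>
    intro v hv
    rcases Nat.eq_zero_or_pos n with rfl | hn
    · simpa using hv
    refine le_antisymm (hle _ v hv) ?_
    by_contra! hlt
    have h1 : K.graph.dist (g ^ n • v) (g ^ (n + 1) • v) = δ := by
      rw [pow_succ, mul_smul, hd, hv]
    -- By `hlt`, the vertex `g ^ n • v` is not between `v` and `g ^ (n + 1) • v`.
    obtain ⟨t, hadj, hvt, hgt⟩ := hK.exists_adj_closer δ (g ^ (n + 1) • v) h1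
      (by rw [ih v hv]; linarith)
    obtain ⟨w, rfl⟩ : ∃ w, t = g ^ n • w := ⟨(g ^ n)⁻¹ • t, by simp⟩
    rw [pow_succ, mul_smul, hd] at hgt
    have hvw : K.graph.Adj v w := by
      have := hG.adj_smul (g ^ n)⁻¹ hadj
      simpa using this
    -- The path from `w` through `g • v` to `g • w` has length (δ - 1) + 1.
    have hw : K.graph.dist w (g • w) = δ := by
      refine le_antisymm ?_ (hδ w)
      have h2 := hconn.dist_triangle (u := w) (v := g • v) (w := g • w)
      rw [hd, SimpleGraph.dist_eq_one_iff_adj.2 hvw, K.graph.dist_comm (u := w) (v := g • v)] at h2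
      omega
    -- Both d(v, gⁿv) and d(w, gⁿw) equal nδ, while d(v, gⁿw) = nδ - 1 and, passing through gv, d(w,
    -- gⁿv) ≤ (δ - 1) + (n - 1)δ.
    refine hinv.not_inverted hK hG hvw (g ^ n) ?_ ?_
    · rw [ih w hw, ← ih v hv]
      omega
    · obtain ⟨m, rfl⟩ : ∃ m, n = m + 1 := ⟨n - 1, by omega⟩
      rw [ih v hv]
      have h3 := hconn.dist_triangle (u := w) (v := g • v) (w := g ^ (m + 1) • v)
      have h4 := hle m v hv
      rw [pow_succ', mul_smul, hd, K.graph.dist_comm (u := w) (v := g • v)] at h3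
      rw [pow_succ', mul_smul, add_mul, one_mul]
      omega

end action

/-! ### Combinatorial lines -/

/-- A bi-infinite combinatorial geodesic. -/
structure IsGeodesicLine (K : CubeComplex V) (x : ℤ → V) : Prop where
  adj : ∀ i, K.graph.Adj (x i) (x (i + 1))
  edist_eq : ∀ (i : ℤ) (k : ℕ), K.graph.edist (x i) (x (i + k)) = k

theorem nonempty_of_mem_cubes {c : Set V} (hc : c ∈ K.cubes) : c.Nonempty := by
  obtain ⟨n, φ, -, rfl⟩ := K.exists_chart c hc
  exact Set.range_nonempty φ

theorem exists_edge_chart {u v : V} (h : K.graph.Adj u v) :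
    ∃ ψ : (Fin 1 → Bool) → V, IsCubeChart K.cubes ψ ∧ (ψ fun _ => false) = u ∧
      (ψ fun _ => true) = v := by
  obtain ⟨n, φ, hφ, hr⟩ := K.exists_chart _ h.2
  obtain ⟨ε, rfl⟩ : u ∈ Set.range φ := hr ▸ Or.inl rfl
  obtain ⟨η, rfl⟩ : v ∈ Set.range φ := hr ▸ Or.inr rfl
  obtain ⟨j, rfl⟩ := hφ.exists_flipAt_of_adj h
  have huniq : ∀ k, k = j := by
    intro k
    have hk : φ (flipAt k ε) ∈ ({φ ε, φ (flipAt j ε)} : Set V) := hr ▸ ⟨_, rfl⟩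
    rcases hk with hk | hk
    · exact absurd (hφ.1 hk) flipAt_ne
    · exact flipAt_inj.1 (hφ.1 hk)
  let σ : Fin 1 ≃ Fin n :=
    ⟨fun _ => j, fun _ => 0, fun _ => Subsingleton.elim _ _, fun k => (huniq k).symm⟩
  refine ⟨_, hφ.reparam σ ε, by simp, ?_⟩
  congr 1
  funext k
  rw [huniq k, flipAt_self]
  simp

theorem cubePoint_nonneg {n : ℕ} (φ : (Fin n → Bool) → V) (t : Fin n → unitInterval) (v : V) :
    0 ≤ cubePoint φ t v := by
  unfold cubePoint
  refine Finset.sum_nonneg fun ε _ => ?_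
  split_ifs
  · refine Finset.prod_nonneg fun i _ => ?_
    split_ifs
    · exact (t i).2.1
    · linarith [(t i).2.2]
  · exact le_rfl

theorem add_weights_eq_one (y : K.Realization) {a b : V} (hab : a ≠ b)
    (h : ∀ v, y.1 v ≠ 0 → v = a ∨ v = b) : y.1 a + y.1 b = 1 := by
  classical
  obtain ⟨_, n, φ, t, hφ, rfl⟩ := y
  dsimp only at h ⊢
  -- The total weight is the expansion of the product of the factors t i + (1 - t i).
  have hsum : ∑ ε : Fin n → Bool, cubePoint φ t (φ ε) = 1 := by
    simp_rw [cubePoint_apply hφ.1]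
    rw [← Fintype.piFinset_univ, ← Finset.prod_univ_sum (fun _ => Finset.univ)
      (fun i (b : Bool) => if b = true then (t i : ℝ) else 1 - (t i : ℝ))]
    simp
  rw [← Finset.sum_pair hab, ← hsum, ← Finset.sum_image (f := fun v => cubePoint φ t v) (g := φ)
    (fun _ _ _ _ h => hφ.1 h)]
  have h1 : ∀ s : Finset V, Finset.univ.image φ ⊆ s → ∑ v ∈ Finset.univ.image φ, cubePoint φ t v =
      ∑ v ∈ s, cubePoint φ t v := by
    intro s hs
    refine Finset.sum_subset hs fun v _ hv => ?_
    by_contra hne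
    obtain ⟨ε, rfl⟩ := mem_range_of_cubePoint_ne_zero hne
    simp at hv
  rw [h1 (Finset.univ.image φ ∪ {a, b}) Finset.subset_union_left]
  refine Finset.sum_subset Finset.subset_union_right fun v _ hv => ?_
  by_contra hne
  exact hv (by simpa using h v hne)

namespace IsGeodesicLine

variable {x : ℤ → V}

theorem injective (hx : K.IsGeodesicLine x) : Function.Injective x := by
  have key : ∀ i j, i ≤ j → x i = x j → i = j := by
    intro i j hij h
    obtain ⟨k, rfl⟩ := Int.le.dest hij
    have := hx.edist_eq i k
    rw [← h, SimpleGraph.edist_self] at this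
    have hk : k = 0 := by exact_mod_cast this.symm
    simp [hk]
  intro i j h
  rcases le_total i j with hij | hij
  · exact key i j hij h
  · exact (key j i hij h.symm).symm

/-- The subcomplex consisting of the vertices and edges of a combinatorial line. -/
def subcomplex (hx : K.IsGeodesicLine x) : K.Subcomplex where
  carrier := {c | ∃ i, c = {x i} ∨ c = {x i, x (i + 1)}}
  carrier_subset := by
    rintro _ ⟨i, rfl | rfl⟩
    exacts [K.singleton_mem _, (hx.adj i).2]
  face_mem := by
    rintro _ ⟨i, rfl | rfl⟩ d hd hsub
    · exact ⟨i, Or.inl ((nonempty_of_mem_cubes hd).subset_singleton_iff.1 hsub)⟩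
    · rcases Set.subset_pair_iff_eq.1 hsub with h | h | h | h
      · exact absurd h (nonempty_of_mem_cubes hd).ne_empty
      · exact ⟨i, Or.inl h⟩
      · exact ⟨i + 1, Or.inl h⟩
      · exact ⟨i, Or.inr h⟩

theorem isometricallyEmbedded (hx : K.IsGeodesicLine x) :
    hx.subcomplex.IsometricallyEmbedded := by
  have hmem : ∀ u, {u} ∈ hx.subcomplex.carrier → ∃ i, u = x i := by
    rintro u ⟨i, h | h⟩
    · exact ⟨i, Set.singleton_injective h⟩
    · exact ⟨i, ((h.symm ▸ Or.inl rfl : x i ∈ ({u} : Set V))).symm⟩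
  have hle : hx.subcomplex.graph ≤ K.graph := fun u v h =>
    ⟨h.1, hx.subcomplex.carrier_subset h.2⟩
  have hwalk : ∀ (i : ℤ) (k : ℕ), ∃ p : hx.subcomplex.graph.Walk (x i) (x (i + k)),
      p.length = k := by
    intro i k
    induction k with
    | zero => exact ⟨SimpleGraph.Walk.nil.copy rfl (by simp), by simp⟩
    | succ k ih =>
      obtain ⟨p, hp⟩ := ih
      have hadj : hx.subcomplex.graph.Adj (x (i + k)) (x (i + k + 1)) :=
        ⟨(hx.adj _).1, i + k, Or.inr rfl⟩
      exact ⟨(p.concat hadj).copy rfl (by push_cast; rw [add_assoc]), by simp [hp]⟩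
  have key : ∀ (i : ℤ) (k : ℕ), hx.subcomplex.graph.edist (x i) (x (i + k)) =
      K.graph.edist (x i) (x (i + k)) := by
    intro i k
    refine le_antisymm ?_ (SimpleGraph.edist_anti hle)
    obtain ⟨p, hp⟩ := hwalk i k
    rw [hx.edist_eq]
    exact (SimpleGraph.edist_le p).trans (by rw [hp])
  intro u v hu hv
  obtain ⟨i, rfl⟩ := hmem u hu
  obtain ⟨j, rfl⟩ := hmem v hv
  rcases le_total i j with hij | hij
  · obtain ⟨k, rfl⟩ := Int.le.dest hij
    exact key i k
  · obtain ⟨k, rfl⟩ := Int.le.dest hij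
    rw [SimpleGraph.edist_comm, key j k, SimpleGraph.edist_comm]

open Classical in
/-- The weights of the point with parameter `r` on the line through the vertices `x i`. -/
noncomputable def weight (x : ℤ → V) (r : ℝ) (v : V) : ℝ :=
  if h : ∃ i, x i = v then max 0 (1 - |r - h.choose|) else 0

theorem weight_apply (hx : K.IsGeodesicLine x) (r : ℝ) (i : ℤ) :
    weight x r (x i) = max 0 (1 - |r - i|) := by
  have h : ∃ j, x j = x i := ⟨i, rfl⟩
  rw [weight, dif_pos h, hx.injective h.choose_spec]

theorem weight_eq_zero {r : ℝ} {v : V} (h : ∀ i, x i ≠ v) : weight x r v = 0 :=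
  dif_neg (by simpa using h)

theorem weight_eq_cubePoint (hx : K.IsGeodesicLine x) (i : ℤ) {ψ : (Fin 1 → Bool) → V}
    (hψ : Function.Injective ψ) (h0 : (ψ fun _ => false) = x i)
    (h1 : (ψ fun _ => true) = x (i + 1)) (t : unitInterval) :
    weight x (i + t) = cubePoint ψ fun _ => t := by
  have ht := t.2
  funext v
  by_cases hv : v ∈ Set.range ψ
  · obtain ⟨ε, rfl⟩ := hv
    rw [cubePoint_apply hψ]
    rcases hε : ε 0 with _ | _
    · obtain rfl : ε = fun _ => false := by funext k; rw [Subsingleton.elim k 0, hε]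
      rw [h0, hx.weight_apply, add_sub_cancel_left, abs_of_nonneg ht.1, max_eq_right]
      · simp
      · linarith [ht.2]
    · obtain rfl : ε = fun _ => true := by funext k; rw [Subsingleton.elim k 0, hε]
      rw [h1, hx.weight_apply]
      push_cast
      rw [add_sub_add_left_eq_sub, abs_of_nonpos (by linarith [ht.2]), max_eq_right]
      · simp
      · linarith [ht.1]
  · have hz : cubePoint ψ (fun _ => t) v = 0 := by
      by_contra hne
      exact hv (mem_range_of_cubePoint_ne_zero hne)
    rw [hz]
    by_cases hj : ∃ j, x j = v
    · obtain ⟨j, rfl⟩ := hj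
      have hji : j ≠ i := by rintro rfl; exact hv ⟨_, h0⟩
      have hji' : j ≠ i + 1 := by rintro rfl; exact hv ⟨_, h1⟩
      rw [hx.weight_apply, max_eq_left]
      rcases lt_or_gt_of_ne hji with h | h
      · have : (j : ℝ) + 1 ≤ i := by exact_mod_cast h
        rw [abs_of_nonneg (by linarith [ht.1])]
        linarith [ht.1]
      · have : (i : ℝ) + 2 ≤ j := by
          have : i + 2 ≤ j := by omega
          exact_mod_cast this
        rw [abs_of_nonpos (by linarith [ht.2])]
        linarith [ht.2]
    · push Not at hj
      exact weight_eq_zero hj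

theorem weight_sub_floor (x : ℤ → V) (r : ℝ) :
    weight x r = weight x (⌊r⌋ + (⟨Int.fract r, Int.fract_nonneg r, (Int.fract_lt_one r).le⟩ :
      unitInterval)) := by
  congr 1
  exact (Int.floor_add_fract r).symm

/-- The parametrization of a combinatorial line by the real numbers. -/
noncomputable def param (hx : K.IsGeodesicLine x) (r : ℝ) : K.Realization :=
  ⟨weight x r, by
    obtain ⟨ψ, hψ, h0, h1⟩ := exists_edge_chart (hx.adj ⌊r⌋)
    exact ⟨1, ψ, _, hψ, (weight_sub_floor x r).trans (hx.weight_eq_cubePoint _ hψ.1 h0 h1 _)⟩⟩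

theorem continuousOn_param (hx : K.IsGeodesicLine x) (i : ℤ) :
    ContinuousOn hx.param (Set.Icc (i : ℝ) (i + 1)) := by
  obtain ⟨ψ, hψ, h0, h1⟩ := exists_edge_chart (hx.adj i)
  have hc : Continuous fun r : ℝ => K.charMap ψ hψ fun _ =>
      Set.projIcc (0 : ℝ) 1 zero_le_one (r - i) := by
    refine (continuous_charMap hψ).comp (continuous_pi fun _ => ?_)
    exact continuous_projIcc.comp (continuous_id.sub continuous_const)
  refine hc.continuousOn.congr fun r hr => Subtype.ext ?_
  change weight x r = cubePoint ψ _
  have hr' : r - i ∈ Set.Icc (0 : ℝ) 1 := ⟨by linarith [hr.1], by linarith [hr.2]⟩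
  rw [← hx.weight_eq_cubePoint i hψ.1 h0 h1, Set.projIcc_of_mem _ hr']
  congr 1
  simp

theorem continuous_param (hx : K.IsGeodesicLine x) : Continuous hx.param := by
  rw [continuous_iff_continuousAt]
  intro r
  -- Two adjacent unit intervals are needed to obtain a neighbourhood of `r` when `r` is an integer.
  have h1 := hx.continuousOn_param (⌊r⌋ - 1)
  have h2 := hx.continuousOn_param ⌊r⌋
  push_cast at h1
  rw [sub_add_cancel] at h1
  have h3 := h1.union_of_isClosed h2 isClosed_Icc isClosed_Icc
  rw [Set.Icc_union_Icc_eq_Icc (by linarith) (by linarith)] at h3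
  refine h3.continuousAt (Icc_mem_nhds ?_ (Int.lt_floor_add_one r))
  linarith [Int.floor_le r]

/-- On the open star of `x i` the parameter is a continuous function of the weights. This yields
both injectivity of the parametrization and continuity of its inverse. -/
theorem eq_of_weight_ne_zero (hx : K.IsGeodesicLine x) {r : ℝ} {i : ℤ}
    (h : weight x r (x i) ≠ 0) :
    r = i + weight x r (x (i + 1)) - weight x r (x (i - 1)) := by
  rw [hx.weight_apply] at h
  have hlt : |r - i| < 1 := by
    by_contra hge
    exact h (max_eq_left (by linarith))
  rw [abs_lt] at hlt
  rw [hx.weight_apply, hx.weight_apply]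
  push_cast
  rcases le_total (i : ℝ) r with hir | hir
  · rw [abs_of_nonpos (show r - (i + 1) ≤ 0 by linarith),
      abs_of_nonneg (show 0 ≤ r - (i - 1) by linarith), max_eq_right (by linarith),
      max_eq_left (by linarith)]
    ring
  · rw [abs_of_nonpos (show r - (i + 1) ≤ 0 by linarith),
      abs_of_nonneg (show 0 ≤ r - (i - 1) by linarith), max_eq_left (by linarith),
      max_eq_right (by linarith)]
    ring

theorem weight_floor_ne_zero (hx : K.IsGeodesicLine x) (r : ℝ) : weight x r (x ⌊r⌋) ≠ 0 := by
  have h1 := Int.floor_le r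
  have h2 := Int.lt_floor_add_one r
  rw [hx.weight_apply, abs_of_nonneg (by linarith), max_eq_right (by linarith)]
  linarith

theorem param_mem_space (hx : K.IsGeodesicLine x) (r : ℝ) : hx.param r ∈ hx.subcomplex.space := by
  refine ⟨_, ⟨⌊r⌋, Or.inr rfl⟩, fun v hv => ?_⟩
  have h1 := Int.floor_le r
  have h2 := Int.lt_floor_add_one r
  change weight x r v ≠ 0 at hv
  by_cases hj : ∃ j, x j = v
  · obtain ⟨j, rfl⟩ := hj
    rw [hx.weight_apply] at hv
    have hlt : |r - j| < 1 := by
      by_contra hge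
      exact hv (max_eq_left (by linarith))
    rw [abs_lt] at hlt
    have h3 : (j : ℝ) < ⌊r⌋ + 2 := by linarith
    have h4 : (⌊r⌋ : ℝ) < j + 1 := by linarith
    have h3' : j < ⌊r⌋ + 2 := by exact_mod_cast h3
    have h4' : ⌊r⌋ < j + 1 := by exact_mod_cast h4
    obtain rfl | rfl : j = ⌊r⌋ ∨ j = ⌊r⌋ + 1 := by omega
    exacts [Or.inl rfl, Or.inr rfl]
  · push Not at hj
    exact absurd (weight_eq_zero hj) hv

theorem exists_param_eq (hx : K.IsGeodesicLine x) {y : K.Realization}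
    (hy : y ∈ hx.subcomplex.space) : ∃ r, hx.param r = y := by
  obtain ⟨i, hi⟩ : ∃ i, ∀ v, y.1 v ≠ 0 → v = x i ∨ v = x (i + 1) := by
    obtain ⟨_, ⟨i, rfl | rfl⟩, h⟩ := hy
    · exact ⟨i, fun v hv => Or.inl (h v hv)⟩
    · exact ⟨i, fun v hv => h v hv⟩
  have hnn : ∀ v, 0 ≤ y.1 v := by
    obtain ⟨_, n, φ, t, hφ, rfl⟩ := y
    exact cubePoint_nonneg φ t
  have hsum := add_weights_eq_one y (hx.adj i).1 hi
  obtain ⟨ψ, hψ, h0, h1⟩ := exists_edge_chart (hx.adj i)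
  let t : unitInterval := ⟨y.1 (x (i + 1)), hnn _, by linarith [hnn (x i)]⟩
  refine ⟨i + t, Subtype.ext ?_⟩
  change weight x (i + t) = y.1
  rw [hx.weight_eq_cubePoint i hψ.1 h0 h1]
  funext v
  by_cases hv0 : v = x i
  · rw [hv0, ← h0, cubePoint_apply hψ.1, h0]
    simp [t]
    linarith
  by_cases hv1 : v = x (i + 1)
  · rw [hv1, ← h1, cubePoint_apply hψ.1, h1]
    simp [t]
  · have hz : y.1 v = 0 := by
      by_contra hne
      rcases hi v hne with h | h
      exacts [hv0 h, hv1 h]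
    rw [hz]
    by_contra hne
    obtain ⟨ε, rfl⟩ := mem_range_of_cubePoint_ne_zero hne
    rcases hε : ε 0 with _ | _
    · exact hv0 (h0 ▸ congrArg ψ (by funext k; rw [Subsingleton.elim k 0, hε]))
    · exact hv1 (h1 ▸ congrArg ψ (by funext k; rw [Subsingleton.elim k 0, hε]))

theorem nonempty_homeomorph (hx : K.IsGeodesicLine x) :
    Nonempty (hx.subcomplex.space ≃ₜ ℝ) := by
  let p : ℝ → hx.subcomplex.space := fun r => ⟨hx.param r, hx.param_mem_space r⟩
  have hp : ∀ r v, (p r).1.1 v = weight x r v := fun _ _ => rfl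
  have hbij : Function.Bijective p := by
    constructor
    · intro r r' h
      have hw : weight x r = weight x r' := congrArg (fun q => q.1.1) h
      have h1 := hx.weight_floor_ne_zero r
      have h2 : weight x r' (x ⌊r⌋) ≠ 0 := hw ▸ h1
      rw [hx.eq_of_weight_ne_zero h1, hx.eq_of_weight_ne_zero h2, hw]
    · rintro ⟨y, hy⟩
      obtain ⟨r, rfl⟩ := hx.exists_param_eq hy
      exact ⟨r, rfl⟩
  let e : ℝ ≃ hx.subcomplex.space := Equiv.ofBijective p hbij
  have hcont : Continuous e := hx.continuous_param.subtype_mk _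
  have hw : ∀ v, Continuous fun y : hx.subcomplex.space => y.1.1 v := fun v =>
    (continuous_weight v).comp continuous_subtype_val
  have hinv : Continuous e.symm := by
    rw [continuous_iff_continuousAt]
    intro y
    obtain ⟨r, rfl⟩ := e.surjective y
    have hne : ∀ᶠ y in nhds (e r), y.1.1 (x ⌊r⌋) ≠ 0 :=
      (hw (x ⌊r⌋)).continuousAt.eventually_ne (hx.weight_floor_ne_zero r)
    have hloc : (fun y : hx.subcomplex.space =>
        (⌊r⌋ : ℝ) + y.1.1 (x (⌊r⌋ + 1)) - y.1.1 (x (⌊r⌋ - 1))) =ᶠ[nhds (e r)] e.symm := by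
      filter_upwards [hne] with y hy
      obtain ⟨r', rfl⟩ := e.surjective y
      rw [Equiv.symm_apply_apply]
      exact (hx.eq_of_weight_ne_zero hy).symm
    exact (((continuous_const.add (hw _)).sub (hw _)).continuousAt).congr hloc
  exact ⟨(Homeomorph.mk e hcont hinv).symm⟩

theorem isCombinatorialGeodesicAxis (hx : K.IsGeodesicLine x) {G : Type*} [Group G]
    [MulAction G V] {g : G} {δ : ℤ} (hg : ∀ i, g • x i = x (i + δ)) :
    K.IsCombinatorialGeodesicAxis g hx.subcomplex where
  invariant := by
    ext c
    constructor
    · rintro ⟨_, ⟨i, rfl | rfl⟩, rfl⟩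
      · exact ⟨i + δ, Or.inl (by simp [Set.smul_set_singleton, hg])⟩
      · refine ⟨i + δ, Or.inr ?_⟩
        dsimp only
        rw [← Set.image_smul, Set.image_pair, hg, hg, add_right_comm]
    · rintro ⟨i, rfl | rfl⟩
      · exact ⟨{x (i - δ)}, ⟨i - δ, Or.inl rfl⟩, by simp [Set.smul_set_singleton, hg]⟩
      · refine ⟨{x (i - δ), x (i - δ + 1)}, ⟨i - δ, Or.inr rfl⟩, ?_⟩
        dsimp only
        rw [← Set.image_smul, Set.image_pair, hg, hg, add_right_comm, sub_add_cancel]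
  isometric := hx.isometricallyEmbedded
  homeomorphic := hx.nonempty_homeomorph

end IsGeodesicLine

/-! ### Existence of axes -/

theorem exists_line {G : Type*} [Group G] [MulAction G V] (hG : K.PreservedBy G)
    (hconn : K.graph.Connected) (g : G) (v : V) {δ : ℕ} (hδ : 0 < δ)
    (hv : ∀ n : ℕ, K.graph.dist v (g ^ n • v) = n * δ) :
    ∃ x : ℤ → V, K.IsGeodesicLine x ∧ ∀ i, g • x i = x (i + δ) := by
  obtain ⟨p, hp⟩ := hconn.exists_walk_length_eq_dist v (g • v)
  have hlen : p.length = δ := by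
    have := hv 1
    rw [pow_one, one_mul] at this
    rw [hp, this]
  have hδ' : (0 : ℤ) < δ := by exact_mod_cast hδ
  -- On [qδ, (q+1)δ] the line follows the translate of `p` by `g ^ q`; consecutive translates fit
  -- because `p` ends at `g • v`.
  let x : ℤ → V := fun i => g ^ (i / δ) • p.getVert (i % δ).toNat
  have hlt : ∀ (q : ℤ) (r : ℕ), r < δ → x (q * δ + r) = g ^ q • p.getVert r := by
    intro q r hr
    have h1 : (q * δ + r) / (δ : ℤ) = q := by
      rw [add_comm, Int.add_mul_ediv_right _ _ hδ'.ne',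
        Int.ediv_eq_zero_of_lt (by positivity) (by exact_mod_cast hr), zero_add]
    have h2 : (q * δ + r) % (δ : ℤ) = r := by
      rw [add_comm, Int.add_mul_emod_self_right, Int.emod_eq_of_lt (by positivity)
        (by exact_mod_cast hr)]
    simp only [x, h1, h2, Int.toNat_natCast]
  have hle : ∀ (q : ℤ) (r : ℕ), r ≤ δ → x (q * δ + r) = g ^ q • p.getVert r := by
    intro q r hr
    rcases hr.lt_or_eq with hr | rfl
    · exact hlt q r hr
    · have := hlt (q + 1) 0 hδ
      rw [SimpleGraph.Walk.getVert_zero, zpow_add_one, mul_smul] at this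
      rw [← hlen, SimpleGraph.Walk.getVert_length, ← this, hlen]
      congr 1
      push_cast
      ring
  have hrep : ∀ i : ℤ, ∃ (q : ℤ) (r : ℕ), r < δ ∧ i = q * δ + r := by
    intro i
    refine ⟨i / δ, (i % δ).toNat, ?_, ?_⟩
    · have := Int.emod_lt_of_pos i hδ'
      have := Int.emod_nonneg i hδ'.ne'
      omega
    · rw [Int.toNat_of_nonneg (Int.emod_nonneg i hδ'.ne')]
      exact (Int.ediv_mul_add_emod i δ).symm
  have hadj : ∀ i, K.graph.Adj (x i) (x (i + 1)) := by
    intro i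
    obtain ⟨q, r, hr, rfl⟩ := hrep i
    have h1 := hle q (r + 1) hr
    push_cast at h1
    rw [hlt q r hr, add_assoc, h1]
    exact hG.adj_smul _ (p.adj_getVert_succ (hlen ▸ hr))
  have hshift : ∀ i, g • x i = x (i + δ) := by
    intro i
    obtain ⟨q, r, hr, rfl⟩ := hrep i
    have h1 := hlt (q + 1) r hr
    rw [add_mul, one_mul, add_right_comm] at h1
    rw [h1, hlt q r hr, ← mul_smul, zpow_add, zpow_one, ← zpow_one_add, add_comm, zpow_add_one]
  have hlip : ∀ (i : ℤ) (k : ℕ), K.graph.dist (x i) (x (i + k)) ≤ k := by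
    intro i k
    induction k with
    | zero => simp
    | succ k ih =>
      have h1 := hconn.dist_triangle (u := x i) (v := x (i + k)) (w := x (i + k + 1))
      rw [SimpleGraph.dist_eq_one_iff_adj.2 (hadj _)] at h1
      push_cast
      rw [← add_assoc]
      omega
  have hdist : ∀ (i : ℤ) (k : ℕ), K.graph.dist (x i) (x (i + k)) = k := by
    intro i k
    refine le_antisymm (hlip i k) ?_
    -- The window [-nδ, nδ] contains i and i + k. Its ends are mapped to vertices at distance 2nδ,
    -- so the Lipschitz bound is attained on every subinterval.
    let n : ℕ := i.natAbs + k
    have hn : (n : ℤ) ≤ n * δ := le_mul_of_one_le_right (by positivity) hδ'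
    obtain ⟨a, ha⟩ := Int.le.dest (show -(n * δ : ℤ) ≤ i by omega)
    obtain ⟨b, hb⟩ := Int.le.dest (show i + k ≤ n * δ by omega)
    have h1 := hlip (-(n * δ : ℤ)) a
    have h2 := hlip (i + k) b
    rw [ha] at h1
    rw [hb] at h2
    have e1 : x (-(n * δ : ℤ)) = (g ^ n)⁻¹ • v := by
      have := hlt (-n) 0 hδ
      simpa using this
    have e2 : x (n * δ) = g ^ n • v := by
      have := hlt n 0 hδ
      simpa using this
    have h3 : K.graph.dist (x (-(n * δ : ℤ))) (x (n * δ)) = (2 * n) * δ := by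
      rw [e1, e2, ← hv (2 * n), ← hG.dist_smul hconn (g ^ n), smul_inv_smul, ← mul_smul, ← pow_add,
        two_mul]
    have h4 := hconn.dist_triangle (u := x (-(n * δ : ℤ))) (v := x i) (w := x (n * δ))
    have h5 := hconn.dist_triangle (u := x i) (v := x (i + k)) (w := x (n * δ))
    have h6 : (2 * n) * δ = a + k + b := by
      have : ((2 * n * δ : ℕ) : ℤ) = ((a + k + b : ℕ) : ℤ) := by
        push_cast
        linarith
      exact_mod_cast this
    omega
  refine ⟨x, ⟨hadj, fun i k => ?_⟩, hshift⟩
  rw [← (hconn (x i) (x (i + k))).coe_dist_eq_edist, hdist]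

end CubeComplex

theorem mainTheorem4 {V G : Type*} [Group G] [MulAction G V] (K : CubeComplex V)
    (hK : K.IsCAT0) (hG : K.PreservedBy G) (hinv : K.WithoutInversions G) (g : G) :
    (∃ v : V, g • v = v) ∨ ∃ Y : K.Subcomplex, K.IsCombinatorialGeodesicAxis g Y := by
  have hconn := hK.connected
  have hne := hconn.nonempty
  -- Displacements are natural numbers, so a minimum is attained.
  obtain ⟨v, hv⟩ : ∃ v : V, ∀ u : V, K.graph.dist v (g • v) ≤ K.graph.dist u (g • u) :=
    ⟨_, fun u => Function.argmin_le (fun v => K.graph.dist v (g • v)) u⟩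
  rcases Nat.eq_zero_or_pos (K.graph.dist v (g • v)) with h0 | hpos
  · exact Or.inl ⟨v, (hconn.dist_eq_zero_iff.1 h0).symm⟩
  · right
    obtain ⟨x, hx, hgx⟩ := CubeComplex.exists_line hG hconn g v hpos
      fun n => hinv.dist_pow_smul hK hG g _ hv n v rfl
    exact ⟨hx.subcomplex, hx.isCombinatorialGeodesicAxis hgx⟩
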